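/- Let $p\ge 1$ be an integer. For integers $n\ge 0$ put $$h_n^{(p)}=\sum_{k=1}^n\frac1{(k-\frac12)^p},\qquad \widetilde t(s)=\sum_{n=1}^\infty\frac1{(n-\frac12)^s}\ (s\ge 2),\qquad \widetilde t(1):=0,$$ and let $\Psi$ be the meromorphic function on $\mathbb C$ given by $$\Psi(-z)=\frac1{z+\frac12}+\sum_{k=1}^\infty\left(\frac1{k-\frac12}-\frac1{k-\frac12-z}\right).$$ Let $r$ be a rational function with complex coefficients such that $r(z)=O(z^{-2})$ as $z\to\infty$, and let $S\subset\mathbb C$ be its finite set of poles. Assume that $0\notin S$ and that $n\notin S$ and $\pm(n-\frac12)\notin S$ for every integer $n\ge1$. Put $$f(z)=\frac{\pi\tan(\pi z)\,\Psi^{(p-1)}(\tfrac12-z)}{(p-1)!}\,r(z),$$ where $\Psi^{(p-1)}(\tfrac12-z)$ is the $(p-1)$-st derivative of $\Psi$ evaluated at $\tfrac12-z$. Then all the infinite series below converge absolutely, and $$-\sum_{n=1}^\infty\Big((-1)^p\,\widetilde t(p)+h_n^{(p)}\Big)r(n-\tfrac12)-(-1)^p\sum_{n=1}^\infty\Big(\widetilde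 t(p)-h_{n-1}^{(p)}\Big)r(\tfrac12-n)$$ $$+\,2\sum_{k=1}^{\lfloor p/2\rfloor}\frac{\widetilde t(2k)}{(p-2k)!}\sum_{n=0}^\infty r^{(p-2k)}(n)+\sum_{\beta\in S}\operatorname{Res}(f,\beta)=0 .$$ -/

import Mathlib

noncomputable section

namespace OddEuler

open Filter Topology

/-- The odd harmonic number `h_n^{(p)} = ∑_{k=1}^n 1 / (k - 1/2)^p`, with `h_0^{(p)} = 0`. -/
def oddHarmonic (p n : ℕ) : ℂ :=
  ∑ k ∈ Finset.Icc 1 n, 1 / ((k : ℂ) - 1 / 2) ^ p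

/-- The value `t̃(s) = ∑_{n ≥ 1} 1 / (n - 1/2)^s` for `s ≥ 2`, with the convention `t̃(1) = 0`.
The summation index is shifted by one. -/
def tTilde (s : ℕ) : ℂ :=
  if s = 1 then 0 else ∑' n : ℕ, 1 / (((n : ℂ) + 1) - 1 / 2) ^ s

/-- The function `Ψ`, given by
`Ψ(-z) = 1 / (z + 1/2) + ∑_{k ≥ 1} (1 / (k - 1/2) - 1 / (k - 1/2 - z))`,
written in the variable `w = -z`, with the summation index shifted by one. -/
def Psi (w : ℂ) : ℂ :=
  1 / (-w + 1 / 2) +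
    ∑' k : ℕ, (1 / (((k : ℂ) + 1) - 1 / 2) - 1 / (((k : ℂ) + 1) - 1 / 2 + w))

/-- The value at `z` of the complex function attached to a rational function. -/
def ratVal (r : RatFunc ℂ) (z : ℂ) : ℂ :=
  r.eval (RingHom.id ℂ) z

/-- The finite set of poles in `ℂ` of a rational function: the zeros of its denominator in lowest
terms (`RatFunc.denom` is coprime to `RatFunc.num`). -/
def ratPoles (r : RatFunc ℂ) : Finset ℂ :=
  r.denom.roots.toFinset

/-- The residue at `c` of a function with an isolated singularity at `c`:
`(2πi)⁻¹ ∮_{|z - c| = ε} f(z) dz` for small `ε > 0`, written as the limit for `ε → 0+`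
(for such a function the integral does not depend on `ε` when `ε` is small). -/
def residue (f : ℂ → ℂ) (c : ℂ) : ℂ :=
  limUnder (𝓝[>] (0 : ℝ))
    (fun ε : ℝ => (2 * (Real.pi : ℂ) * Complex.I)⁻¹ * circleIntegral f c ε)

/-- The function `f(z) = π tan(πz) Ψ^{(p-1)}(1/2 - z) r(z) / (p-1)!`, where `Ψ^{(p-1)}(1/2 - z)` is
the `(p-1)`-st derivative of `Ψ`, evaluated at `1/2 - z`. -/
def integrand (p : ℕ) (r : RatFunc ℂ) (z : ℂ) : ℂ :=
  (Real.pi : ℂ) * Complex.tan ((Real.pi : ℂ) * z) * iteratedDeriv (p - 1) Psi (1 / 2 - z)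
    / ((p - 1).factorial : ℂ) * ratVal r z

end OddEuler

end

/-! Integrate `f` over the circles `|z| = N + 1/4`. There `tan (π z)` is bounded, the normalized
derivative of `Ψ` is `o(N)` and `r` is `O(N⁻²)`, so the integrals tend to `0` and the sum of all
residues vanishes.

Everything rests on `H(u) = ∑ (1/(k+1/2) - 1/(k+1/2-u))`, called `halfDigamma`, since `Ψ(1/2 - z) =
1/z + H(z - 1/2)`. Two identities carry the computation: the shift `H(u-1) = H(u) + 1/(1/2-u)` and
the reflection `H(-u) - H(u) = π tan (π u)`. The Taylor coefficients of `H` at `0` are the numbers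
`-t̃(i+1)`, and the shift carries them to all integers, where odd harmonic numbers appear. At a
half-integer `π tan (π z)` has a simple pole of residue `-1`, which gives the first two series. At
an integer `n ≥ 0` the factor from `Ψ` has principal part `(z-n)⁻ᵖ`, so the residue is a Taylor
coefficient of `π tan (π z) r(z)`; by reflection only odd powers of the tangent occur, whence the
numbers `t̃(2k)`.

For the growth, dominated convergence gives `H(u) = o(|u|)` for `Re u ≤ 1/4`, reflection covers the
other half plane, and Cauchy's estimates pass to derivatives. -/

noncomputable section
namespace OddEuler
open Filter Topology Metric Complex
open scoped Real

/-! ### Residues and the residue theorem on a disc -/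

/-- The integrals of `f` over all small circles around `c` equal `2πi a`. -/
def HasResidue (f : ℂ → ℂ) (c a : ℂ) : Prop :=
  ∀ᶠ ε in 𝓝[>] (0 : ℝ), circleIntegral f c ε = 2 * π * I * a

theorem HasResidue.residue_eq {f : ℂ → ℂ} {c a : ℂ} (h : HasResidue f c a) :
    residue f c = a := by
  refine Tendsto.limUnder_eq (Tendsto.congr' ?_ tendsto_const_nhds)
  filter_upwards [h] with ε hε
  rw [hε, inv_mul_cancel_left₀ two_pi_I_ne_zero]

theorem eventually_circle {c : ℂ} {p : ℂ → Prop} (h : ∀ᶠ z in 𝓝[≠] c, p z) :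
    ∀ᶠ ε in 𝓝[>] (0 : ℝ), ∀ z ∈ closedBall c ε, z ≠ c → p z := by
  rw [eventually_nhdsWithin_iff] at h
  obtain ⟨δ, hδ, hp⟩ := Metric.eventually_nhds_iff_ball.1 h
  filter_upwards [Ioo_mem_nhdsGT hδ] with ε hε z hz hzc
  exact hp z (closedBall_subset_ball hε.2 hz) hzc

theorem eventually_closedBall {c : ℂ} {p : ℂ → Prop} (h : ∀ᶠ z in 𝓝 c, p z) :
    ∀ᶠ ε in 𝓝[>] (0 : ℝ), ∀ z ∈ closedBall c ε, p z := by
  obtain ⟨δ, hδ, hp⟩ := Metric.eventually_nhds_iff_ball.1 h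
  filter_upwards [Ioo_mem_nhdsGT hδ] with ε hε z hz
  exact hp z (closedBall_subset_ball hε.2 hz)

theorem circleIntegral_eq_zero_of_differentiableAt {g : ℂ → ℂ} {c : ℂ} {R : ℝ} (hR : 0 ≤ R)
    (hg : ∀ z ∈ closedBall c R, DifferentiableAt ℂ g z) : circleIntegral g c R = 0 :=
  circleIntegral_eq_zero_of_differentiable_on_off_countable hR Set.countable_empty
    (fun z hz => (hg z hz).continuousAt.continuousWithinAt)
    (fun z hz => hg z (ball_subset_closedBall hz.1))

theorem circleIntegrable_of_differentiableAt {g : ℂ → ℂ} {c : ℂ} {R : ℝ} (hR : 0 ≤ R)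
    (hg : ∀ z ∈ sphere c R, DifferentiableAt ℂ g z) : CircleIntegrable g c R :=
  ContinuousOn.circleIntegrable hR fun z hz => (hg z hz).continuousAt.continuousWithinAt

/-- `q` is a function with a single singularity, at `c`, of residue `a`, and `f - q` has a
removable singularity at `c`. -/
structure IsPrincipalPart (f q : ℂ → ℂ) (c a : ℂ) : Prop where
  differentiableAt : ∀ z ≠ c, DifferentiableAt ℂ q z
  integral : ∀ w R, c ∈ ball w R → circleIntegral q w R = 2 * π * I * a
  removable : ∃ g, AnalyticAt ℂ g c ∧ ∀ᶠ z in 𝓝[≠] c, f z = q z + g z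

theorem IsPrincipalPart.hasResidue {f q : ℂ → ℂ} {c a : ℂ} (h : IsPrincipalPart f q c a) :
    HasResidue f c a := by
  obtain ⟨g, hg, hf⟩ := h.removable
  filter_upwards [self_mem_nhdsWithin, eventually_circle hf,
    eventually_closedBall hg.eventually_analyticAt] with ε hε h1 h2
  have hε' : (0 : ℝ) < ε := hε
  have hne : ∀ z ∈ sphere c ε, z ≠ c := fun z hz => ne_of_mem_sphere hz hε'.ne'
  rw [circleIntegral.integral_congr hε'.le (g := fun z => q z + g z)
    (fun z hz => h1 z (sphere_subset_closedBall hz) (hne z hz)),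
    circleIntegral.integral_add
      (circleIntegrable_of_differentiableAt hε'.le fun z hz => h.differentiableAt z (hne z hz))
      (circleIntegrable_of_differentiableAt hε'.le fun z hz =>
        (h2 z (sphere_subset_closedBall hz)).differentiableAt),
    circleIntegral_eq_zero_of_differentiableAt hε'.le fun z hz => (h2 z hz).differentiableAt,
    h.integral _ _ (mem_ball_self hε'), add_zero]

/-- Induction on the pole order: splitting `H = H(c) + (z - c) H₁` peels off one pure power of `z -
c`, which has a nonzero integral only when the exponent is `-1`. -/
theorem exists_isPrincipalPart_of_pow_mul (c : ℂ) (n : ℕ) (f H : ℂ → ℂ) (hH : AnalyticAt ℂ H c)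
    (hf : ∀ᶠ z in 𝓝[≠] c, f z = H z / (z - c) ^ n) : ∃ q a, IsPrincipalPart f q c a := by
  induction n generalizing f H with
  | zero =>
    refine ⟨0, 0, fun z _ => differentiableAt_const 0, fun w R _ => ?_, H, hH, ?_⟩
    · simp [circleIntegral]
    · filter_upwards [hf] with z hz
      simp [hz]
  | succ n ih =>
    obtain ⟨H₁, hH₁, hHH⟩ : ∃ H₁, AnalyticAt ℂ H₁ c ∧ ∀ z, H z = H c + (z - c) * H₁ z := by
      refine ⟨dslope H c, ?_, fun z => ?_⟩
      · obtain ⟨p, hp⟩ := hH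
        exact ⟨_, hp.has_fpower_series_dslope_fslope⟩
      · have := sub_smul_dslope H c z
        rw [smul_eq_mul] at this
        rw [this]; ring
    obtain ⟨q, a, hq⟩ := ih (fun z => H₁ z / (z - c) ^ n) H₁ hH₁ (Eventually.of_forall fun _ => rfl)
    have hd : ∀ z ≠ c, DifferentiableAt ℂ (fun z => H c * (z - c) ^ (-(n + 1 : ℤ))) z := by
      intro z hz
      refine DifferentiableAt.const_mul (DifferentiableAt.zpow (by fun_prop) (Or.inl ?_)) _
      exact sub_ne_zero.2 hz
    obtain ⟨g, hg, hg'⟩ := hq.removable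
    have hint : ∃ b : ℂ, ∀ w R, c ∈ ball w R →
        circleIntegral (fun z => H c * (z - c) ^ (-(n + 1 : ℤ))) w R = 2 * π * I * b := by
      rcases Nat.eq_zero_or_pos n with rfl | hn
      · refine ⟨H c, fun w R hw => ?_⟩
        rw [circleIntegral.integral_const_mul]
        simp [circleIntegral.integral_sub_inv_of_mem_ball hw]
        ring
      · refine ⟨0, fun w R _ => ?_⟩
        rw [circleIntegral.integral_const_mul,
          circleIntegral.integral_sub_zpow_of_ne (by omega)]
        simp
    obtain ⟨b, hb⟩ := hint
    refine ⟨fun z => H c * (z - c) ^ (-(n + 1 : ℤ)) + q z, b + a,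
      fun z hz => (hd z hz).add (hq.differentiableAt z hz), fun w R hw => ?_, g, hg, ?_⟩
    · have hR : 0 ≤ R := dist_nonneg.trans (mem_ball.1 hw).le
      have hne : ∀ z ∈ sphere w R, z ≠ c := by
        rintro z hz rfl
        exact (mem_ball.1 hw).ne (mem_sphere.1 hz)
      rw [circleIntegral.integral_add
        (circleIntegrable_of_differentiableAt hR fun z hz => hd z (hne z hz))
        (circleIntegrable_of_differentiableAt hR fun z hz => hq.differentiableAt z (hne z hz)),
        hb w R hw, hq.integral w R hw]
      ring
    · filter_upwards [hf, hg', self_mem_nhdsWithin] with z h1 h2 h3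
      have h3' : z - c ≠ 0 := sub_ne_zero.2 h3
      rw [h1, add_assoc, ← h2, hHH z, zpow_neg]
      have : (z - c) ^ ((n : ℤ) + 1) = (z - c) ^ (n + 1) := by exact_mod_cast rfl
      rw [this, pow_succ]
      field_simp

theorem exists_isPrincipalPart {f : ℂ → ℂ} {c : ℂ} (hf : MeromorphicAt f c) :
    ∃ q a, IsPrincipalPart f q c a := by
  obtain ⟨n, hn⟩ := hf
  refine exists_isPrincipalPart_of_pow_mul c n f _ hn ?_
  filter_upwards [self_mem_nhdsWithin] with z hz
  have : z - c ≠ 0 := sub_ne_zero.2 hz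
  simp only [smul_eq_mul]
  field_simp

/-- The residue theorem on a disc. -/
theorem circleIntegral_eq_sum_residue {w : ℂ} {R : ℝ} (hR : 0 ≤ R) (T : Finset ℂ) :
    ∀ f : ℂ → ℂ, (∀ t ∈ T, t ∈ ball w R) → (∀ t ∈ T, MeromorphicAt f t) →
      (∀ z ∈ closedBall w R, z ∉ T → DifferentiableAt ℂ f z) →
      circleIntegral f w R = 2 * π * I * ∑ t ∈ T, residue f t := by
  induction T using Finset.induction_on with
  | empty =>
    intro f _ _ hd
    rw [circleIntegral_eq_zero_of_differentiableAt hR fun z hz => hd z hz (by simp)]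
    simp
  | insert t T ht ih =>
    intro f hball hmer hd
    have htb : t ∈ ball w R := hball t (Finset.mem_insert_self t T)
    obtain ⟨q, a, hq⟩ := exists_isPrincipalPart (hmer t (Finset.mem_insert_self t T))
    obtain ⟨g, hg, hfg⟩ := hq.removable
    -- Removing the principal part at `t` and filling in the missing value leaves a function whose
    -- only singularities lie in `T`.
    set F : ℂ → ℂ := Function.update (fun z => f z - q z) t (g t) with hF
    have hFne : ∀ s, s ≠ t → F =ᶠ[𝓝 s] fun z => f z - q z := fun s hs => by
      filter_upwards [isOpen_ne.mem_nhds hs] with z hz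
      simp [hF, Function.update_of_ne hz]
    have hFt : F =ᶠ[𝓝 t] g := by
      rw [eventually_nhdsWithin_iff] at hfg
      filter_upwards [hfg] with z hz
      rcases eq_or_ne z t with rfl | hzt
      · simp [hF]
      · simp [hF, Function.update_of_ne hzt, hz hzt]
    have hqan : ∀ s, s ≠ t → AnalyticAt ℂ q s := fun s hs =>
      DifferentiableOn.analyticAt (s := {t}ᶜ)
        (fun z hz => (hq.differentiableAt z hz).differentiableWithinAt) (isOpen_ne.mem_nhds hs)
    have hne : ∀ s ∈ T, s ≠ t := fun s hs h => ht (h ▸ hs)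
    have hsne : ∀ z ∈ sphere w R, z ≠ t := by
      rintro z hz rfl
      exact (mem_ball.1 htb).ne (mem_sphere.1 hz)
    have hfd : ∀ z ∈ sphere w R, DifferentiableAt ℂ f z := fun z hz =>
      hd z (sphere_subset_closedBall hz) fun hzT =>
        (mem_ball.1 (hball z hzT)).ne (mem_sphere.1 hz)
    have key := ih F (fun s hs => hball s (Finset.mem_insert_of_mem hs))
      (fun s hs => by
        have h1 : MeromorphicAt (fun z => f z - q z) s :=
          (hmer s (Finset.mem_insert_of_mem hs)).sub (hqan s (hne s hs)).meromorphicAt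
        exact h1.congr ((hFne s (hne s hs)).symm.filter_mono nhdsWithin_le_nhds))
      (fun z hz hzT => by
        rcases eq_or_ne z t with rfl | hzt
        · exact hFt.differentiableAt_iff.2 hg.differentiableAt
        · exact (hFne z hzt).differentiableAt_iff.2
            ((hd z hz (by simp [hzt, hzT])).sub (hq.differentiableAt z hzt)))
    rw [circleIntegral.integral_congr hR (g := fun z => f z - q z)
      (fun z hz => (hFne z (hsne z hz)).self_of_nhds),
      circleIntegral.integral_sub (circleIntegrable_of_differentiableAt hR hfd)
        (circleIntegrable_of_differentiableAt hR fun z hz => hq.differentiableAt z (hsne z hz)),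
      hq.integral w R htb, sub_eq_iff_eq_add] at key
    rw [key, Finset.sum_insert ht, hq.hasResidue.residue_eq, add_comm, ← mul_add]
    congr 2
    -- At the other points `q` is analytic, so subtracting it changes no residue.
    refine Finset.sum_congr rfl fun s hs => ?_
    obtain ⟨q', a', hq'⟩ := exists_isPrincipalPart (hmer s (Finset.mem_insert_of_mem hs))
    have : IsPrincipalPart F q' s a' := by
      obtain ⟨g', hg', hfg'⟩ := hq'.removable
      refine ⟨hq'.differentiableAt, hq'.integral, fun z => g' z - q z,
        hg'.sub (hqan s (hne s hs)), ?_⟩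
      filter_upwards [hfg', (hFne s (hne s hs)).filter_mono nhdsWithin_le_nhds] with z h1 h2
      rw [h2, h1]; ring
    rw [hq'.hasResidue.residue_eq, this.hasResidue.residue_eq]

/-- Cauchy's formula for the `n`-th derivative evaluates the polar term, and `A` integrates to zero.
-/
theorem residue_eq_of_pole {f H A : ℂ → ℂ} {c : ℂ} (n : ℕ) (hH : AnalyticAt ℂ H c)
    (hA : AnalyticAt ℂ A c) (hf : ∀ᶠ z in 𝓝[≠] c, f z = H z / (z - c) ^ (n + 1) + A z) :
    residue f c = iteratedDeriv n H c / n.factorial := by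
  apply HasResidue.residue_eq
  filter_upwards [self_mem_nhdsWithin, eventually_circle hf,
    eventually_closedBall hA.eventually_analyticAt,
    eventually_closedBall hH.eventually_analyticAt] with ε hε h1 h2 h3
  have hε' : (0 : ℝ) < ε := hε
  have hne : ∀ z ∈ sphere c ε, z ≠ c := fun z hz => ne_of_mem_sphere hz hε'.ne'
  have h4 := DifferentiableOn.circleIntegral_one_div_sub_center_pow_smul hε' n
    (fun z hz => (h3 z hz).differentiableAt.differentiableWithinAt)
  rw [circleIntegral.integral_congr hε'.le
    (g := fun z => (1 / (z - c) ^ (n + 1)) • H z + A z)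
    (fun z hz => by
      simp only [h1 z (sphere_subset_closedBall hz) (hne z hz), smul_eq_mul]; ring),
    circleIntegral.integral_add, h4,
    circleIntegral_eq_zero_of_differentiableAt hε'.le fun z hz => (h2 z hz).differentiableAt,
    smul_eq_mul]
  · ring
  · refine circleIntegrable_of_differentiableAt hε'.le fun z hz => ?_
    have h5 := (h3 z (sphere_subset_closedBall hz)).differentiableAt
    have h6 : (z - c) ^ (n + 1) ≠ 0 := pow_ne_zero _ (sub_ne_zero.2 (hne z hz))
    simp only [smul_eq_mul]
    fun_prop (disch := assumption)
  · exact circleIntegrable_of_differentiableAt hε'.le fun z hz =>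
      (h2 z (sphere_subset_closedBall hz)).differentiableAt

/-! ### The series `halfDigamma`: convergence, shift and poles -/

theorem analyticAt_iteratedDeriv {f : ℂ → ℂ} {x : ℂ} (h : AnalyticAt ℂ f x) (n : ℕ) :
    AnalyticAt ℂ (iteratedDeriv n f) x := by
  induction n with
  | zero => simpa using h
  | succ n ih => rw [iteratedDeriv_succ]; exact ih.deriv

theorem iteratedDeriv_one_div_const_sub (i : ℕ) (a u : ℂ) :
    iteratedDeriv i (fun u => 1 / (a - u)) u = i.factorial / (a - u) ^ (i + 1) := by
  have h := congrFun (iter_deriv_inv_linear i (-1 : ℂ) a) u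
  have h1 : (fun x : ℂ => (-1 * x + a)⁻¹) = fun u => 1 / (a - u) := by
    ext x; rw [one_div]; congr 1; ring
  rw [h1, ← iteratedDeriv_eq_iterate] at h
  have h2 : -1 * u + a = a - u := by ring
  have h3 : (-1 - (i : ℤ)) = -((i + 1 : ℕ) : ℤ) := by push_cast; ring
  rw [h, h2, h3, zpow_neg, zpow_natCast, div_eq_mul_inv, mul_right_comm ((-1 : ℂ) ^ i),
    ← mul_pow]
  simp

/-- The function `ψ(1/2 - u) - ψ(1/2)`, as a series over its poles `k + 1/2`. -/
def halfDigamma (u : ℂ) : ℂ :=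
  ∑' k : ℕ, (1 / ((k : ℂ) + 1 / 2) - 1 / ((k : ℂ) + 1 / 2 - u))

theorem summable_inv_half_sq : Summable fun k : ℕ => (((k : ℝ) + 1 / 2) ^ 2)⁻¹ := by
  have h := ((summable_nat_add_iff 1).2 (Real.summable_nat_pow_inv.2 one_lt_two)).mul_left 4
  refine Summable.of_nonneg_of_le (fun k => by positivity) (fun k => ?_) h
  push_cast
  rw [← inv_inv (4 : ℝ), ← mul_inv]
  apply inv_anti₀ (by positivity)
  have : (0 : ℝ) ≤ k := k.cast_nonneg
  nlinarith

theorem half_norm (k : ℕ) : ‖(k : ℂ) + 1 / 2‖ = (k : ℝ) + 1 / 2 := by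
  have : (k : ℂ) + 1 / 2 = (((k : ℝ) + 1 / 2 : ℝ) : ℂ) := by push_cast; rfl
  rw [this, Complex.norm_real, Real.norm_of_nonneg (by positivity)]

theorem half_ne_zero (k : ℕ) : (k : ℂ) + 1 / 2 ≠ 0 := by
  rw [← norm_ne_zero_iff, half_norm]; positivity

/-- The difference equals `-u / ((k+1/2)(k+1/2-u))`, and the hypothesis bounds the second factor
below by half of the first. -/
theorem norm_halfDigamma_term_le {k : ℕ} {u : ℂ}
    (h : ((k : ℝ) + 1 / 2) / 2 ≤ ‖(k : ℂ) + 1 / 2 - u‖) :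
    ‖1 / ((k : ℂ) + 1 / 2) - 1 / ((k : ℂ) + 1 / 2 - u)‖ ≤
      2 * ‖u‖ * (((k : ℝ) + 1 / 2) ^ 2)⁻¹ := by
  have h0 : (0 : ℝ) < (k : ℝ) + 1 / 2 := by positivity
  have h1 : (0 : ℝ) < ‖(k : ℂ) + 1 / 2 - u‖ := by linarith
  have h2 : (k : ℂ) + 1 / 2 - u ≠ 0 := norm_pos_iff.1 h1
  rw [div_sub_div _ _ (half_ne_zero k) h2, norm_div, norm_mul, half_norm,
    show 1 * ((k : ℂ) + 1 / 2 - u) - ((k : ℂ) + 1 / 2) * 1 = -u by ring, norm_neg,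
    ← div_eq_mul_inv, div_le_div_iff₀ (by positivity) (by positivity)]
  have := mul_le_mul_of_nonneg_left h (by positivity : 0 ≤ ‖u‖ * ((k : ℝ) + 1 / 2))
  nlinarith

theorem summable_halfDigamma (u : ℂ) :
    Summable fun k : ℕ => 1 / ((k : ℂ) + 1 / 2) - 1 / ((k : ℂ) + 1 / 2 - u) := by
  refine Summable.of_norm_bounded_eventually_nat (summable_inv_half_sq.mul_left (2 * ‖u‖)) ?_
  filter_upwards [eventually_ge_atTop ⌈2 * ‖u‖⌉₊] with k hk
  apply norm_halfDigamma_term_le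
  have h1 : 2 * ‖u‖ ≤ k := Nat.ceil_le.1 hk
  have h2 := norm_sub_norm_le ((k : ℂ) + 1 / 2) u
  rw [half_norm] at h2
  linarith

/-- The threshold `1/4` is forced by `k = 0`, where the pole is at `1/2`. -/
theorem half_le_norm_sub {u : ℂ} (hu : u.re ≤ 1 / 4) (k : ℕ) :
    ((k : ℝ) + 1 / 2) / 2 ≤ ‖(k : ℂ) + 1 / 2 - u‖ := by
  have h := Complex.re_le_norm ((k : ℂ) + 1 / 2 - u)
  have h2 : ((k : ℂ) + 1 / 2 - u).re = (k : ℝ) + 1 / 2 - u.re := by simp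
  rw [h2] at h
  have : (0 : ℝ) ≤ k := k.cast_nonneg
  linarith

theorem half_sub_ne_zero {u : ℂ} (hu : u.re ≤ 1 / 4) (k : ℕ) : (k : ℂ) + 1 / 2 - u ≠ 0 := by
  have := half_le_norm_sub hu k
  rw [← norm_pos_iff]
  have : (0 : ℝ) < ((k : ℝ) + 1 / 2) / 2 := by positivity
  linarith

theorem tendsto_one_div_half_sub (u : ℂ) :
    Tendsto (fun k : ℕ => 1 / ((k : ℂ) + 1 / 2 - u)) atTop (𝓝 0) := by
  simp only [one_div]
  refine tendsto_inv₀_cobounded.comp ?_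
  rw [← tendsto_norm_atTop_iff_cobounded]
  refine tendsto_atTop_mono (f := fun k : ℕ => (k : ℝ) + (1 / 2 - ‖u‖)) (fun k => ?_)
    (tendsto_atTop_add_const_right _ _ tendsto_natCast_atTop_atTop)
  have h2 := norm_sub_norm_le ((k : ℂ) + 1 / 2) u
  rw [half_norm] at h2
  simp only [one_div] at *
  linarith

/-- The difference of the two series telescopes. Only identical terms cancel, so with `1/0 = 0` the
identity holds at the poles too. -/
theorem halfDigamma_sub_one (u : ℂ) : halfDigamma (u - 1) = halfDigamma u + 1 / (1 / 2 - u) := by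
  have h1 := ((summable_halfDigamma (u - 1)).hasSum.sub
    (summable_halfDigamma u).hasSum).tendsto_sum_nat
  have h2 : ∀ n : ℕ, ∑ k ∈ Finset.range n,
      (1 / ((k : ℂ) + 1 / 2) - 1 / ((k : ℂ) + 1 / 2 - (u - 1)) -
        (1 / ((k : ℂ) + 1 / 2) - 1 / ((k : ℂ) + 1 / 2 - u))) =
      1 / (1 / 2 - u) - 1 / ((n : ℂ) + 1 / 2 - u) := by
    intro n
    induction n with
    | zero => simp
    | succ n ih =>
      rw [Finset.sum_range_succ, ih]
      push_cast
      rw [show (n : ℂ) + 1 + 1 / 2 - u = n + 1 / 2 - (u - 1) by ring]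
      ring
  simp only [h2] at h1
  have h3 := tendsto_nhds_unique h1 (tendsto_const_nhds.sub (tendsto_one_div_half_sub u))
  rw [sub_zero] at h3
  exact sub_eq_iff_eq_add'.1 h3

theorem halfDigamma_eq_sub_nat (u : ℂ) (K : ℕ) : halfDigamma u =
    halfDigamma (u - K) - ∑ j ∈ Finset.range K, 1 / ((j : ℂ) + 1 / 2 - u) := by
  induction K with
  | zero => simp
  | succ K ih =>
    rw [ih, Finset.sum_range_succ, Nat.cast_succ,
      show u - ((K : ℂ) + 1) = (u - K) - 1 by ring, halfDigamma_sub_one,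
      show (1 : ℂ) / 2 - (u - K) = K + 1 / 2 - u by ring]
    ring

/-- A bounded piece of the half plane `Re u < 1/4`. -/
def leftRegion (M : ℝ) : Set ℂ := {u | u.re < 1 / 4} ∩ ball 0 M

theorem isOpen_leftRegion (M : ℝ) : IsOpen (leftRegion M) :=
  (isOpen_lt Complex.continuous_re continuous_const).inter isOpen_ball

theorem norm_halfDigamma_term_le_of_mem {M : ℝ} {u : ℂ} (hu : u ∈ leftRegion M) (k : ℕ) :
    ‖1 / ((k : ℂ) + 1 / 2) - 1 / ((k : ℂ) + 1 / 2 - u)‖ ≤ 2 * M * (((k : ℝ) + 1 / 2) ^ 2)⁻¹ := by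
  refine (norm_halfDigamma_term_le (half_le_norm_sub (le_of_lt hu.1) k)).trans ?_
  have : ‖u‖ ≤ M := (mem_ball_zero_iff.1 hu.2).le
  gcongr

theorem analyticAt_halfDigamma_term {k : ℕ} {u : ℂ} (h : (k : ℂ) + 1 / 2 - u ≠ 0) :
    AnalyticAt ℂ (fun u => 1 / ((k : ℂ) + 1 / 2) - 1 / ((k : ℂ) + 1 / 2 - u)) u := by
  fun_prop (disch := assumption)

theorem analyticAt_halfDigamma_of_re_lt {u : ℂ} (hu : u.re < 1 / 4) :
    AnalyticAt ℂ halfDigamma u := by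
  have h := differentiableOn_tsum_of_summable_norm (U := leftRegion (‖u‖ + 1))
    (F := fun (k : ℕ) (u : ℂ) => 1 / ((k : ℂ) + 1 / 2) - 1 / ((k : ℂ) + 1 / 2 - u))
    (summable_inv_half_sq.mul_left (2 * (‖u‖ + 1)))
    (fun k v hv => (analyticAt_halfDigamma_term
      (half_sub_ne_zero (le_of_lt hv.1) k)).differentiableAt.differentiableWithinAt)
    (isOpen_leftRegion _) (fun k v hv => norm_halfDigamma_term_le_of_mem hv k)
  exact h.analyticAt ((isOpen_leftRegion _).mem_nhds ⟨hu, by simp⟩)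

/-- All large `K` are allowed, so that `K` can also be taken beyond the index of a given pole. -/
theorem exists_analyticAt_shift (u : ℂ) : ∃ K₀ : ℕ, ∀ K ≥ K₀,
    AnalyticAt ℂ (fun v => halfDigamma (v - K)) u := by
  refine ⟨⌈u.re⌉₊, fun K hK => ?_⟩
  have : AnalyticAt ℂ halfDigamma (u - K) := by
    apply analyticAt_halfDigamma_of_re_lt
    have : u.re ≤ K := Nat.ceil_le.1 hK
    simp only [sub_re, natCast_re]
    linarith
  exact this.comp_of_eq (f := fun v : ℂ => v - K) (by fun_prop) rfl

theorem analyticAt_halfDigamma {u : ℂ} (hu : ∀ k : ℕ, (k : ℂ) + 1 / 2 - u ≠ 0) :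
    AnalyticAt ℂ halfDigamma u := by
  obtain ⟨K, hK⟩ := exists_analyticAt_shift u
  rw [funext fun v => halfDigamma_eq_sub_nat v K]
  refine (hK K le_rfl).sub (Finset.analyticAt_fun_sum _ fun j _ => ?_)
  have := hu j
  fun_prop (disch := assumption)

theorem exists_analyticAt_add_pole (j : ℕ) : ∃ g : ℂ → ℂ, AnalyticAt ℂ g ((j : ℂ) + 1 / 2) ∧
    ∀ u, halfDigamma u = g u - 1 / ((j : ℂ) + 1 / 2 - u) := by
  obtain ⟨K₀, hK⟩ := exists_analyticAt_shift ((j : ℂ) + 1 / 2)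
  set K := max K₀ (j + 1)
  refine ⟨fun u => halfDigamma (u - K) -
    ∑ i ∈ (Finset.range K).erase j, 1 / ((i : ℂ) + 1 / 2 - u), ?_, fun u => ?_⟩
  · refine (hK K (le_max_left _ _)).sub (Finset.analyticAt_fun_sum _ fun i hi => ?_)
    have : (i : ℂ) + 1 / 2 - (j + 1 / 2) ≠ 0 := by
      rw [add_sub_add_right_eq_sub, sub_ne_zero, Nat.cast_injective.ne_iff]
      exact (Finset.mem_erase.1 hi).1
    fun_prop (disch := assumption)
  · have : j ∈ Finset.range K := Finset.mem_range.2 (le_max_right K₀ (j + 1))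
    rw [halfDigamma_eq_sub_nat u K, ← Finset.add_sum_erase _ _ this]
    ring

/-! ### Taylor coefficients of `halfDigamma` at the integers -/

/-- Local uniform convergence allows termwise differentiation. For `i = 0` the value is `0`, which
is where the convention `t̃(1) = 0` fits. -/
theorem iteratedDeriv_halfDigamma_zero (i : ℕ) :
    iteratedDeriv i halfDigamma 0 / i.factorial = -tTilde (i + 1) := by
  rcases Nat.eq_zero_or_pos i with rfl | hi
  · simp [tTilde, halfDigamma]
  set t : ℕ → ℂ → ℂ := fun k u => 1 / ((k : ℂ) + 1 / 2) - 1 / ((k : ℂ) + 1 / 2 - u) with ht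
  set U := leftRegion 1
  have hUo : IsOpen U := isOpen_leftRegion 1
  have h0 : (0 : ℂ) ∈ U := by simp [U, leftRegion]
  have htan : ∀ k, ∀ u ∈ U, AnalyticAt ℂ (t k) u := fun k u hu =>
    analyticAt_halfDigamma_term (half_sub_ne_zero (le_of_lt hu.1) k)
  have hlim : ∀ i, TendstoLocallyUniformlyOn
      (fun n => iteratedDeriv i (fun u => ∑ k ∈ Finset.range n, t k u))
      (iteratedDeriv i halfDigamma) atTop U := by
    intro i
    induction i with
    | zero =>
      simp only [iteratedDeriv_zero]
      exact (tendstoUniformlyOn_tsum_nat (summable_inv_half_sq.mul_left (2 * 1))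
        fun k u hu => norm_halfDigamma_term_le_of_mem hu k).tendstoLocallyUniformlyOn
    | succ i ih =>
      simp only [iteratedDeriv_succ]
      refine ih.deriv (Eventually.of_forall fun n u hu => ?_) hUo
      exact (analyticAt_iteratedDeriv (Finset.analyticAt_fun_sum _ fun k _ => htan k u hu)
        i).differentiableAt.differentiableWithinAt
  have h1 := (hlim i).tendsto_at h0
  have h2 : ∀ n, iteratedDeriv i (fun u => ∑ k ∈ Finset.range n, t k u) 0 =
      ∑ k ∈ Finset.range n, -(i.factorial : ℂ) * (1 / (((k : ℂ) + 1) - 1 / 2) ^ (i + 1)) := by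
    intro n
    rw [iteratedDeriv_fun_sum fun k _ => (htan k 0 h0).contDiffAt]
    refine Finset.sum_congr rfl fun k _ => ?_
    rw [ht, iteratedDeriv_const_sub hi, iteratedDeriv_neg, iteratedDeriv_one_div_const_sub,
      sub_zero, show (k : ℂ) + 1 - 1 / 2 = k + 1 / 2 by ring]
    ring
  simp only [h2] at h1
  have h3 : Summable fun k : ℕ => 1 / (((k : ℂ) + 1) - 1 / 2) ^ (i + 1) := by
    -- Two factors give the convergent majorant; each of the other `i - 1` is at most `2`.
    refine Summable.of_norm_bounded (summable_inv_half_sq.mul_left (2 ^ (i - 1))) fun k => ?_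
    rw [show (k : ℂ) + 1 - 1 / 2 = k + 1 / 2 by ring, norm_div, norm_pow, half_norm, norm_one,
      show i + 1 = (i - 1) + 2 by omega, pow_add, one_div, mul_inv]
    gcongr
    rw [← inv_pow]
    gcongr
    rw [inv_le_comm₀ (by positivity) (by positivity)]
    have : (0 : ℝ) ≤ k := k.cast_nonneg
    linarith
  have h4 := tendsto_nhds_unique h1 (h3.hasSum.mul_left (-(i.factorial : ℂ))).tendsto_sum_nat
  have h5 : (i.factorial : ℂ) ≠ 0 := Nat.cast_ne_zero.2 i.factorial_ne_zero
  rw [h4, tTilde, if_neg (by omega)]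
  rw [neg_mul, neg_div, mul_div_cancel_left₀ _ h5]

theorem iteratedDeriv_halfDigamma_sub_one (i : ℕ) {u : ℂ}
    (hu : ∀ k : ℕ, (k : ℂ) + 1 / 2 - u ≠ 0) :
    iteratedDeriv i halfDigamma (u - 1) / i.factorial =
      iteratedDeriv i halfDigamma u / i.factorial + 1 / (1 / 2 - u) ^ (i + 1) := by
  have h := congrFun (iteratedDeriv_comp_sub_const i halfDigamma 1) u
  have h1 : (fun z => halfDigamma (z - 1)) = halfDigamma + fun u => 1 / (1 / 2 - u) := by
    ext z; exact halfDigamma_sub_one z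
  have h2 : (1 : ℂ) / 2 - u ≠ 0 := by simpa using hu 0
  have h3 : AnalyticAt ℂ (fun u : ℂ => 1 / (1 / 2 - u)) u := by fun_prop (disch := assumption)
  rw [h1, iteratedDeriv_add (analyticAt_halfDigamma hu).contDiffAt h3.contDiffAt,
    iteratedDeriv_one_div_const_sub] at h
  have h5 : (i.factorial : ℂ) ≠ 0 := Nat.cast_ne_zero.2 i.factorial_ne_zero
  rw [← h]
  field_simp

theorem half_sub_int_ne_zero (k : ℕ) (m : ℤ) : (k : ℂ) + 1 / 2 - m ≠ 0 := by
  intro h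
  have h1 : (2 * k + 1 - 2 * m : ℂ) = 0 := by linear_combination 2 * h
  have h2 : (2 * k + 1 - 2 * m : ℤ) = 0 := by exact_mod_cast h1
  omega

theorem oddHarmonic_succ (p n : ℕ) :
    oddHarmonic p (n + 1) = oddHarmonic p n + 1 / ((n : ℂ) + 1 / 2) ^ p := by
  rw [oddHarmonic, Finset.sum_Icc_succ_top (by omega), oddHarmonic]
  push_cast
  rw [show (n : ℂ) + 1 - 1 / 2 = n + 1 / 2 by ring]

theorem oddHarmonic_zero (p : ℕ) : oddHarmonic p 0 = 0 := by simp [oddHarmonic]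

theorem iteratedDeriv_halfDigamma_neg_nat (i m : ℕ) :
    iteratedDeriv i halfDigamma (-m) / i.factorial =
      oddHarmonic (i + 1) m - tTilde (i + 1) := by
  induction m with
  | zero => simpa [oddHarmonic_zero] using iteratedDeriv_halfDigamma_zero i
  | succ m ih =>
    have h := iteratedDeriv_halfDigamma_sub_one i (u := -(m : ℂ))
      (fun k => by simpa using half_sub_int_ne_zero k (-m))
    rw [ih] at h
    rw [oddHarmonic_succ, Nat.cast_succ, show -((m : ℂ) + 1) = -m - 1 by ring, h,
      show (1 : ℂ) / 2 - -m = m + 1 / 2 by ring]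
    ring

/-- A step to the right subtracts a power of `1/(1/2 - u)` with negative base `-(n + 1/2)`, hence
the sign `(-1) ^ i`. -/
theorem iteratedDeriv_halfDigamma_nat (i n : ℕ) :
    iteratedDeriv i halfDigamma n / i.factorial =
      (-1) ^ i * oddHarmonic (i + 1) n - tTilde (i + 1) := by
  induction n with
  | zero => simpa [oddHarmonic_zero] using iteratedDeriv_halfDigamma_zero i
  | succ n ih =>
    have h := iteratedDeriv_halfDigamma_sub_one i (u := (n : ℂ) + 1)
      (fun k => by simpa using half_sub_int_ne_zero k (n + 1))
    rw [add_sub_cancel_right, ih, show (1 : ℂ) / 2 - (n + 1) = -(n + 1 / 2) by ring,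
      neg_pow ((n : ℂ) + 1 / 2), div_mul_eq_div_div] at h
    rw [oddHarmonic_succ, Nat.cast_succ]
    have h1 : (1 : ℂ) / (-1) ^ (i + 1) = - (-1) ^ i := by
      rcases neg_one_pow_eq_or ℂ i with h | h <;> rw [pow_succ, h] <;> norm_num
    rw [h1] at h
    linear_combination -h

/-! ### Reflection formula and growth on large circles -/

/-- This is the partial fraction series of the cotangent at `u - 1/2`. That series pairs poles
symmetrically about `1/2` instead of `0`; the partial sums differ by one term that cancels `1/(u -
1/2)` and one that tends to `0`. -/
theorem halfDigamma_reflection {u : ℂ} (hu : u - 1 / 2 ∈ integerComplement) :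
    halfDigamma (-u) - halfDigamma u = π * Complex.tan (π * u) := by
  have hx := cot_series_rep' hu
  have hs : Summable fun n : ℕ => 1 / (u - 1 / 2 - (n + 1)) + 1 / (u - 1 / 2 + (n + 1)) :=
    summable_cotTerm hu
  have h1 := hs.hasSum.tendsto_sum_nat
  rw [← hx] at h1
  have h2 := ((summable_halfDigamma u).hasSum.sub
    (summable_halfDigamma (-u)).hasSum).tendsto_sum_nat
  have h3 : ∀ n : ℕ, ∑ k ∈ Finset.range n,
      (1 / (u - 1 / 2 - ((k : ℂ) + 1)) + 1 / (u - 1 / 2 + ((k : ℂ) + 1))) =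
      ∑ k ∈ Finset.range n, (1 / ((k : ℂ) + 1 / 2) - 1 / ((k : ℂ) + 1 / 2 - u) -
        (1 / ((k : ℂ) + 1 / 2) - 1 / ((k : ℂ) + 1 / 2 - -u))) +
      (1 / (1 / 2 - u) - 1 / ((n : ℂ) + 1 / 2 - u)) := by
    intro n
    induction n with
    | zero => simp
    | succ n ih =>
      rw [Finset.sum_range_succ, ih, Finset.sum_range_succ]
      push_cast
      rw [show u - 1 / 2 - ((n : ℂ) + 1) = -(n + 1 + 1 / 2 - u) by ring,
        show u - 1 / 2 + ((n : ℂ) + 1) = n + 1 / 2 - -u by ring, one_div_neg_eq_neg_one_div]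
      ring
  simp only [h3] at h1
  have h4 := tendsto_nhds_unique h1
    (h2.add (tendsto_const_nhds.sub (tendsto_one_div_half_sub u)))
  have h5 : Complex.cot (π * (u - 1 / 2)) = -Complex.tan (π * u) := by
    rw [Complex.cot_eq_cos_div_sin, Complex.tan_eq_sin_div_cos, mul_sub,
      show (π : ℂ) * (1 / 2) = π / 2 by ring, Complex.cos_sub_pi_div_two,
      Complex.sin_sub_pi_div_two, div_neg]
  have h6 : (1 : ℂ) / (u - 1 / 2) = -(1 / (1 / 2 - u)) := by
    rw [← neg_sub, one_div_neg_eq_neg_one_div]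
  rw [h5, h6] at h4
  change halfDigamma (-u) - halfDigamma u = _
  change _ = (halfDigamma u - halfDigamma (-u)) + _ at h4
  linear_combination h4

/-- Dominated convergence: after division by `u` each term tends to `0` and is at most `2/(k+1/2)²`.
-/
theorem tendsto_halfDigamma_div :
    Tendsto (fun u => halfDigamma u / u) (Bornology.cobounded ℂ ⊓ 𝓟 {u | u.re ≤ 1 / 4}) (𝓝 0) := by
  have h := tendsto_tsum_of_dominated_convergence
    (𝓕 := Bornology.cobounded ℂ ⊓ 𝓟 {u : ℂ | u.re ≤ 1 / 4})
    (f := fun u (k : ℕ) => (1 / ((k : ℂ) + 1 / 2) - 1 / ((k : ℂ) + 1 / 2 - u)) / u)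
    (g := fun _ => 0) (summable_inv_half_sq.mul_left 2) ?_ ?_
  · simp only [tsum_div_const, tsum_zero] at h
    exact h
  · intro k
    refine Tendsto.mono_left ?_ inf_le_left
    have h1 : Tendsto (fun u : ℂ => u⁻¹) (Bornology.cobounded ℂ) (𝓝 0) := tendsto_inv₀_cobounded
    have h2 : Tendsto (fun u : ℂ => ((k : ℂ) + 1 / 2 - u)⁻¹) (Bornology.cobounded ℂ) (𝓝 0) := by
      refine tendsto_inv₀_cobounded.comp ?_
      rw [← tendsto_norm_atTop_iff_cobounded]
      refine tendsto_atTop_mono (f := fun u : ℂ => ‖u‖ + (-‖(k : ℂ) + 1 / 2‖)) (fun u => ?_)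
        (tendsto_atTop_add_const_right _ _ tendsto_norm_cobounded_atTop)
      have := norm_sub_norm_le u ((k : ℂ) + 1 / 2)
      rw [norm_sub_rev] at this
      linarith
    have h3 := ((tendsto_const_nhds (x := 1 / ((k : ℂ) + 1 / 2))).sub h2).mul h1
    simp only [mul_zero] at h3
    simpa only [div_eq_mul_inv, one_mul] using h3
  · filter_upwards [mem_inf_of_right (mem_principal_self _)] with u hu k
    rcases eq_or_ne u 0 with rfl | hu0
    · simp; positivity
    rw [norm_div, div_le_iff₀ (norm_pos_iff.2 hu0)]
    refine (norm_halfDigamma_term_le (half_le_norm_sub hu k)).trans_eq ?_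
    ring

theorem norm_sq_sin (z : ℂ) : ‖Complex.sin z‖ ^ 2 = Real.sin z.re ^ 2 + Real.sinh z.im ^ 2 := by
  rw [Complex.sq_norm, Complex.normSq_apply, Complex.sin_eq, ← Complex.ofReal_sin,
    ← Complex.ofReal_cos, ← Complex.ofReal_sinh, ← Complex.ofReal_cosh]
  simp only [← Complex.ofReal_mul, add_re, add_im, ofReal_re, ofReal_im, mul_re, mul_im, I_re, I_im]
  have h1 := Real.cosh_sq z.im
  have h2 := Real.sin_sq_add_cos_sq z.re
  linear_combination Real.sin z.re ^ 2 * h1 + Real.sinh z.im ^ 2 * h2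

/-- An annulus that stays away from all integers and half-integers. -/
def annulus (N : ℕ) : Set ℂ := {z | |‖z‖ - ((N : ℝ) + 1 / 4)| ≤ 1 / 8}

theorem mem_annulus {N : ℕ} {z : ℂ} :
    z ∈ annulus N ↔ -(1 / 8) ≤ ‖z‖ - ((N : ℝ) + 1 / 4) ∧ ‖z‖ - ((N : ℝ) + 1 / 4) ≤ 1 / 8 := by
  rw [annulus, Set.mem_ofPred_eq, abs_le]

theorem sin_pi_div_eight_pos : 0 < Real.sin (π / 8) :=
  Real.sin_pos_of_pos_of_lt_pi (by positivity) (by linarith [Real.pi_pos])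

/-- The zeros of `sin (2πz)` are the integers and half-integers, so one bound serves both tangent
and cotangent. If `|Im z| ≥ 1/4` the `sinh` term suffices; otherwise `2π(|Re z| - N)` lies in `[π/8,
3π/4]`. -/
theorem le_norm_sin_of_mem_annulus {N : ℕ} (hN : 1 ≤ N) {z : ℂ} (hz : z ∈ annulus N) :
    Real.sin (π / 8) ≤ ‖Complex.sin (2 * (π * z))‖ := by
  have hpi := Real.pi_gt_three
  have hN' : (1 : ℝ) ≤ N := by exact_mod_cast hN
  obtain ⟨hz1, hz2⟩ := mem_annulus.1 hz
  have hre : (2 * (π * z) : ℂ).re = 2 * π * z.re := by simp; ring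
  have him : (2 * (π * z) : ℂ).im = 2 * π * z.im := by simp; ring
  have hsq := norm_sq_sin (2 * (π * z))
  rw [hre, him] at hsq
  have hpos := sin_pi_div_eight_pos
  refine le_of_sq_le_sq ?_ (norm_nonneg _)
  rw [hsq]
  rcases le_or_gt (1 / 4) |z.im| with hy | hy
  · have h1 : 1 ≤ |Real.sinh (2 * π * z.im)| := by
      rw [Real.abs_sinh, abs_mul, abs_of_pos (by positivity : 0 < 2 * π)]
      refine le_trans ?_ (Real.self_le_sinh_iff.2 (by positivity))
      nlinarith
    have h2 := Real.sin_le_one (π / 8)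
    have h3 : 1 ≤ Real.sinh (2 * π * z.im) ^ 2 := by
      rw [← sq_abs]; nlinarith
    nlinarith [sq_nonneg (Real.sin (2 * π * z.re))]
  · have h0 : ‖z‖ ^ 2 = z.re ^ 2 + z.im ^ 2 := by
      rw [Complex.sq_norm, Complex.normSq_apply]; ring
    have h1 : |z.re| ≤ N + 3 / 8 := (Complex.abs_re_le_norm z).trans (by linarith)
    have h2 : (N : ℝ) + 1 / 16 ≤ |z.re| := by
      have hy2 : z.im ^ 2 ≤ (1 / 4) ^ 2 := by rw [← sq_abs]; gcongr
      refine le_of_sq_le_sq ?_ (abs_nonneg _)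
      rw [sq_abs]
      have : ((N : ℝ) + 1 / 8) ^ 2 ≤ ‖z‖ ^ 2 := by gcongr; linarith
      nlinarith
    have h3 : Real.sin (2 * π * z.re) ^ 2 = Real.sin (2 * π * (|z.re| - N)) ^ 2 := by
      have h4 : Real.sin (2 * π * (|z.re| - N)) = Real.sin (2 * π * |z.re|) := by
        rw [show 2 * π * (|z.re| - N) = 2 * π * |z.re| - N * (2 * π) by ring,
          Real.sin_sub_nat_mul_two_pi]
      rw [h4]
      rcases abs_choice z.re with h | h <;> rw [h]
      rw [mul_neg, Real.sin_neg, neg_sq]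
    rw [h3]
    set θ := 2 * π * (|z.re| - N) with hθ
    have h5 : π / 8 ≤ θ := by rw [hθ]; nlinarith
    have h6 : θ ≤ 3 * π / 4 := by rw [hθ]; nlinarith
    have h7 : Real.sin (π / 8) ≤ Real.sin θ := by
      rcases le_or_gt θ (π / 2) with h | h
      · exact Real.sin_le_sin_of_le_of_le_pi_div_two (by linarith) h h5
      · rw [← Real.sin_pi_sub θ]
        exact Real.sin_le_sin_of_le_of_le_pi_div_two (by linarith) (by linarith) (by linarith)
    nlinarith [sq_nonneg (Real.sinh (2 * π * z.im))]

/-- From `s/k + k/s = 2/(2sk)`: either `|s/k| ≤ 1` or `|k/s| ≤ 1`. -/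
theorem norm_div_le_of_sq_add_sq {s k : ℂ} {c : ℝ} (hc : 0 < c) (h : s ^ 2 + k ^ 2 = 1)
    (hsk : c ≤ ‖2 * s * k‖) : ‖s / k‖ ≤ 2 / c + 1 := by
  have hpos : (0 : ℝ) < 2 / c := by positivity
  have hne : 2 * s * k ≠ 0 := norm_pos_iff.1 (hc.trans_le hsk)
  have hk : k ≠ 0 := right_ne_zero_of_mul hne
  have hs : s ≠ 0 := right_ne_zero_of_mul (left_ne_zero_of_mul hne)
  rcases le_or_gt ‖s / k‖ 1 with h1 | h1
  · linarith
  · have h2 : s / k = 2 / (2 * s * k) - (s / k)⁻¹ := by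
      field_simp
      linear_combination h
    have h3 : ‖(s / k)⁻¹‖ ≤ 1 := by rw [norm_inv]; exact inv_le_one_of_one_le₀ h1.le
    calc ‖s / k‖ = ‖2 / (2 * s * k) - (s / k)⁻¹‖ := by rw [← h2]
      _ ≤ ‖2 / (2 * s * k)‖ + ‖(s / k)⁻¹‖ := norm_sub_le _ _
      _ ≤ 2 / c + 1 := by
        rw [norm_div, Complex.norm_two]
        gcongr

/-- A bound for `tan (π z)` and `cot (π z)` on the annuli. -/
def tanBound : ℝ := 2 / Real.sin (π / 8) + 1

theorem tanBound_pos : 0 < tanBound := by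
  have := sin_pi_div_eight_pos
  unfold tanBound; positivity

theorem norm_tan_le {N : ℕ} (hN : 1 ≤ N) {z : ℂ} (hz : z ∈ annulus N) :
    ‖Complex.tan (π * z)‖ ≤ tanBound := by
  have h := le_norm_sin_of_mem_annulus hN hz
  rw [Complex.sin_two_mul] at h
  exact norm_div_le_of_sq_add_sq sin_pi_div_eight_pos (Complex.sin_sq_add_cos_sq _) h

theorem norm_tan_sub_half_le {N : ℕ} (hN : 1 ≤ N) {z : ℂ} (hz : z ∈ annulus N) :
    ‖Complex.tan (π * (z - 1 / 2))‖ ≤ tanBound := by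
  have h := le_norm_sin_of_mem_annulus hN hz
  rw [Complex.sin_two_mul, mul_right_comm] at h
  rw [Complex.tan_eq_sin_div_cos, mul_sub, show (π : ℂ) * (1 / 2) = π / 2 by ring,
    Complex.sin_sub_pi_div_two, Complex.cos_sub_pi_div_two, neg_div, norm_neg]
  exact norm_div_le_of_sq_add_sq sin_pi_div_eight_pos (Complex.cos_sq_add_sin_sq _) h

theorem ne_int_of_mem_annulus {N : ℕ} (hN : 1 ≤ N) {z : ℂ} (hz : z ∈ annulus N) (m : ℤ) :
    z ≠ m := by
  rintro rfl
  have h := le_norm_sin_of_mem_annulus hN hz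
  rw [Complex.sin_two_mul, mul_comm (π : ℂ), Complex.sin_int_mul_pi, mul_zero, zero_mul,
    norm_zero] at h
  exact h.not_gt sin_pi_div_eight_pos

theorem norm_halfDigamma_le_of_mem_annulus {ε : ℝ} (hε : 0 < ε) :
    ∀ᶠ N : ℕ in atTop, ∀ z ∈ annulus N, ‖halfDigamma (z - 1 / 2)‖ ≤ ε * N := by
  -- As `|z - 1/2| ≤ 2N`, the constant `ε/4` costs `(ε/2)N`; the other half absorbs the tangent from
  -- the reflection.
  have h := (Metric.tendsto_nhds.1 tendsto_halfDigamma_div) (ε / 4) (by positivity)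
  rw [eventually_inf_principal] at h
  obtain ⟨M, -, hM⟩ := (hasBasis_cobounded_norm (E := ℂ)).eventually_iff.1 h
  filter_upwards [eventually_ge_atTop 1, eventually_ge_atTop ⌈M + 1⌉₊,
    eventually_ge_atTop ⌈2 * (π * tanBound) / ε⌉₊] with N hN hNM hNt z hz
  have hN' : (1 : ℝ) ≤ N := by exact_mod_cast hN
  have hNM' : M + 1 ≤ N := Nat.ceil_le.1 hNM
  have hNt' : π * tanBound ≤ ε / 2 * N := by
    have := Nat.ceil_le.1 hNt
    rw [div_le_iff₀ hε] at this
    linarith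
  obtain ⟨hz1, hz2⟩ := mem_annulus.1 hz
  have h1 : ‖z - 1 / 2‖ ≤ 2 * N := by
    refine (norm_sub_le _ _).trans ?_
    norm_num
    linarith
  have h2 : M ≤ ‖z - 1 / 2‖ := by
    have := norm_sub_norm_le z (1 / 2)
    norm_num at this ⊢
    linarith
  have key : ∀ u : ℂ, ‖u‖ = ‖z - 1 / 2‖ → u.re ≤ 1 / 4 → ‖halfDigamma u‖ ≤ ε / 2 * N := by
    intro u hu hre
    have h3 := hM (x := u) (by simpa [hu] using h2) hre
    rw [dist_zero_right, norm_div] at h3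
    rcases eq_or_ne u 0 with rfl | hu0
    · simp [halfDigamma]; positivity
    · rw [div_lt_iff₀ (norm_pos_iff.2 hu0)] at h3
      rw [hu] at h3
      nlinarith
  rcases le_or_gt (z - 1 / 2).re (1 / 4) with hre | hre
  · refine (key _ rfl hre).trans ?_
    nlinarith
  · have h4 : z - 1 / 2 - 1 / 2 ∈ integerComplement := by
      rintro ⟨m, hm⟩
      apply ne_int_of_mem_annulus hN hz (m + 1)
      push_cast
      rw [hm]; ring
    have h5 := halfDigamma_reflection h4
    have h6 : halfDigamma (z - 1 / 2) = halfDigamma (-(z - 1 / 2)) -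
        π * Complex.tan (π * (z - 1 / 2)) := by rw [← h5]; ring
    rw [h6]
    refine (norm_sub_le _ _).trans ?_
    have h7 := key (-(z - 1 / 2)) (norm_neg _) (by rw [neg_re]; linarith)
    have h8 : ‖(π : ℂ) * Complex.tan (π * (z - 1 / 2))‖ ≤ π * tanBound := by
      rw [norm_mul, Complex.norm_real, Real.norm_of_nonneg Real.pi_pos.le]
      gcongr
      exact norm_tan_sub_half_le hN hz
    linarith

/-- Cauchy's estimate on discs of radius `1/8`, which stay in the annulus; its factor `8 ^ i` is
paid for in advance. -/
theorem norm_iteratedDeriv_halfDigamma_le (i : ℕ) {ε : ℝ} (hε : 0 < ε) :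
    ∀ᶠ N : ℕ in atTop, ∀ z ∈ sphere (0 : ℂ) (N + 1 / 4),
      ‖iteratedDeriv i halfDigamma (z - 1 / 2) / i.factorial‖ ≤ ε * N := by
  filter_upwards [norm_halfDigamma_le_of_mem_annulus (ε := ε / 8 ^ i) (by positivity),
    eventually_ge_atTop 1] with N hN hN1 z hz
  have hz' : ‖z‖ = N + 1 / 4 := by simpa using hz
  have hmem : ∀ v ∈ closedBall (z - 1 / 2) (1 / 8), v + 1 / 2 ∈ annulus N := by
    intro v hv
    rw [mem_closedBall, dist_eq_norm] at hv
    have := abs_norm_sub_norm_le (v + 1 / 2) z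
    rw [hz'] at this
    refine this.trans (le_of_eq_of_le ?_ hv)
    congr 1; ring
  have h := norm_iteratedDeriv_le_of_forall_mem_sphere_norm_le (c := z - 1 / 2) (R := 1 / 8)
    (C := ε / 8 ^ i * N) (f := halfDigamma) i (by norm_num) ?_ ?_
  · rw [norm_div, Complex.norm_natCast, div_le_iff₀ (by positivity)]
    refine h.trans_eq ?_
    rw [one_div, inv_pow, div_inv_eq_mul]
    field_simp
  · apply DifferentiableOn.diffContOnCl
    rw [closure_ball _ (by norm_num)]
    intro v hv
    refine (analyticAt_halfDigamma fun k hk => ?_).differentiableAt.differentiableWithinAt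
    apply ne_int_of_mem_annulus hN1 (hmem v hv) (k + 1)
    push_cast
    linear_combination -hk
  · intro v hv
    have := hN _ (hmem v (sphere_subset_closedBall hv))
    simpa using this

/-! ### Taylor coefficients of the tangent -/

theorem iteratedDeriv_pi_tan_zero (i : ℕ) :
    iteratedDeriv i (fun z : ℂ => π * Complex.tan (π * z)) 0 / i.factorial =
      (1 - (-1) ^ i) * tTilde (i + 1) := by
  have h0 : (fun z : ℂ => π * Complex.tan (π * z)) =ᶠ[𝓝 0]
      (fun u => halfDigamma (-u)) - halfDigamma := by
    have : {u : ℂ | u.re < 1 / 2} ∩ {u : ℂ | -1 / 2 < u.re} ∈ 𝓝 (0 : ℂ) :=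
      ((isOpen_lt Complex.continuous_re continuous_const).inter
        (isOpen_lt continuous_const Complex.continuous_re)).mem_nhds (by norm_num)
    filter_upwards [this] with u hu
    refine (halfDigamma_reflection ?_).symm
    rintro ⟨m, hm⟩
    have hm' := congrArg Complex.re hm
    simp only [intCast_re, sub_re] at hm'
    norm_num at hm'
    have h1 : u.re < 1 / 2 := hu.1
    have h2 : -1 / 2 < u.re := hu.2
    have h3 : (m : ℝ) < 0 := by linarith
    have h4 : (-1 : ℝ) < m := by linarith
    have h5 : m < 0 := by exact_mod_cast h3
    have h6 : -1 < m := by exact_mod_cast h4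
    omega
  have ha : AnalyticAt ℂ halfDigamma 0 := analyticAt_halfDigamma_of_re_lt (by norm_num)
  have hb : AnalyticAt ℂ (fun u => halfDigamma (-u)) 0 :=
    AnalyticAt.comp_of_eq (g := halfDigamma) (f := fun u : ℂ => -u) ha (by fun_prop) (by simp)
  rw [h0.iteratedDeriv_eq, iteratedDeriv_sub hb.contDiffAt ha.contDiffAt, iteratedDeriv_comp_neg,
    neg_zero, smul_eq_mul, sub_div, mul_div_assoc, iteratedDeriv_halfDigamma_zero]
  ring

theorem iteratedDeriv_pi_tan_nat (i n : ℕ) :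
    iteratedDeriv i (fun z : ℂ => π * Complex.tan (π * z)) n / i.factorial =
      (1 - (-1) ^ i) * tTilde (i + 1) := by
  rw [← iteratedDeriv_pi_tan_zero]
  have h := congrFun (iteratedDeriv_comp_sub_const i
    (fun z : ℂ => π * Complex.tan (π * z)) n) n
  rw [sub_self] at h
  rw [← h]
  congr 2
  ext z
  rw [mul_sub, mul_comm (π : ℂ) n, Complex.tan_periodic.sub_nat_mul_eq]

/-! ### Values and poles of the normalized derivatives of `Psi` -/

theorem Psi_eq (w : ℂ) : Psi w = 1 / (1 / 2 - w) + halfDigamma (-w) := by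
  rw [Psi, halfDigamma, neg_add_eq_sub]
  congr 1
  refine tsum_congr fun k => ?_
  rw [show (k : ℂ) + 1 - 1 / 2 = k + 1 / 2 by ring, sub_neg_eq_add]

theorem half_sub_sub_half_ne_zero {z : ℂ} (hz : ∀ k : ℕ, z ≠ k) (k : ℕ) :
    (k : ℂ) + 1 / 2 - (z - 1 / 2) ≠ 0 := by
  intro h
  apply hz (k + 1)
  push_cast
  linear_combination -h

theorem analyticAt_halfDigamma_neg {z : ℂ} (hz : ∀ k : ℕ, z ≠ k) :
    AnalyticAt ℂ (fun w => halfDigamma (-w)) (1 / 2 - z) :=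
  AnalyticAt.comp_of_eq (g := halfDigamma) (f := fun w : ℂ => -w)
    (analyticAt_halfDigamma (half_sub_sub_half_ne_zero hz)) (by fun_prop) (by ring)

theorem analyticAt_Psi {z : ℂ} (hz : ∀ k : ℕ, z ≠ k) : AnalyticAt ℂ Psi (1 / 2 - z) := by
  rw [funext Psi_eq]
  have : (1 : ℂ) / 2 - (1 / 2 - z) ≠ 0 := by simpa using hz 0
  exact AnalyticAt.add (by fun_prop (disch := assumption)) (analyticAt_halfDigamma_neg hz)

/-- The normalized derivative `Ψ^(i)(1/2 - z) / i!`. -/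
def polyPsi (i : ℕ) (z : ℂ) : ℂ := iteratedDeriv i Psi (1 / 2 - z) / i.factorial

theorem analyticAt_polyPsi (i : ℕ) {z : ℂ} (hz : ∀ k : ℕ, z ≠ k) :
    AnalyticAt ℂ (polyPsi i) z := by
  have h : AnalyticAt ℂ (fun z => iteratedDeriv i Psi (1 / 2 - z)) z :=
    AnalyticAt.comp_of_eq (f := fun z : ℂ => 1 / 2 - z)
      (analyticAt_iteratedDeriv (analyticAt_Psi hz) i) (by fun_prop) rfl
  exact h.div_const

theorem polyPsi_eq (i : ℕ) {z : ℂ} (hz : ∀ k : ℕ, z ≠ k) :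
    polyPsi i z = 1 / z ^ (i + 1) +
      (-1) ^ i * (iteratedDeriv i halfDigamma (z - 1 / 2) / i.factorial) := by
  have h1 : (1 : ℂ) / 2 - (1 / 2 - z) ≠ 0 := by simpa using hz 0
  have h2 : AnalyticAt ℂ (fun w : ℂ => 1 / (1 / 2 - w)) (1 / 2 - z) := by
    fun_prop (disch := assumption)
  have h5 : (i.factorial : ℂ) ≠ 0 := Nat.cast_ne_zero.2 i.factorial_ne_zero
  rw [polyPsi, show Psi = (fun w : ℂ => 1 / (1 / 2 - w)) + fun w => halfDigamma (-w) from
    funext Psi_eq, iteratedDeriv_add h2.contDiffAt (analyticAt_halfDigamma_neg hz).contDiffAt,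
    iteratedDeriv_one_div_const_sub, iteratedDeriv_comp_neg, neg_sub, sub_sub_cancel, smul_eq_mul]
  field_simp

theorem half_add_ne_nat (n k : ℕ) : (n : ℂ) + 1 / 2 ≠ k := fun h =>
  half_sub_int_ne_zero n k (by push_cast; linear_combination h)

theorem neg_half_add_ne_nat (n k : ℕ) : -((n : ℂ) + 1 / 2) ≠ k := fun h =>
  half_sub_int_ne_zero n (-k) (by push_cast; linear_combination -h)

/-- The summand `1/z ^ (i+1)` supplies the last term of the harmonic sum, raising its index from `n`
to `n + 1`. -/
theorem polyPsi_half (i n : ℕ) : polyPsi i ((n : ℂ) + 1 / 2) =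
    (-1) ^ (i + 1) * tTilde (i + 1) + oddHarmonic (i + 1) (n + 1) := by
  rw [polyPsi_eq i (half_add_ne_nat n), add_sub_cancel_right, iteratedDeriv_halfDigamma_nat,
    oddHarmonic_succ, mul_sub, ← mul_assoc, ← mul_pow]
  simp only [mul_neg, mul_one, neg_neg, one_pow, pow_succ]
  ring

/-- Here `1/z ^ (i+1)` cancels the last term instead, lowering the index from `n + 1` to `n`. -/
theorem polyPsi_neg_half (i n : ℕ) : polyPsi i (-((n : ℂ) + 1 / 2)) =
    (-1) ^ (i + 1) * (tTilde (i + 1) - oddHarmonic (i + 1) n) := by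
  rw [polyPsi_eq i (neg_half_add_ne_nat n),
    show -((n : ℂ) + 1 / 2) - 1 / 2 = -((n + 1 : ℕ) : ℂ) by push_cast; ring,
    iteratedDeriv_halfDigamma_neg_nat, oddHarmonic_succ, neg_pow ((n : ℂ) + 1 / 2)]
  have h1 : (1 : ℂ) / ((-1) ^ (i + 1) * ((n : ℂ) + 1 / 2) ^ (i + 1)) =
      (-1) ^ (i + 1) * (1 / ((n : ℂ) + 1 / 2) ^ (i + 1)) := by
    rw [div_mul_eq_div_div]
    rcases neg_one_pow_eq_or ℂ (i + 1) with h | h <;> rw [h] <;> ring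
  rw [h1, pow_succ (-1 : ℂ)]
  ring

theorem eventually_ne_nat (n : ℕ) : ∀ᶠ z : ℂ in 𝓝[≠] (n : ℂ), ∀ k : ℕ, z ≠ (k : ℂ) := by
  filter_upwards [self_mem_nhdsWithin, mem_nhdsWithin_of_mem_nhds (ball_mem_nhds (n : ℂ) one_pos)]
    with z hz hb k hk
  rw [hk, mem_ball, dist_eq_norm] at hb
  have h1 : ((k : ℂ) - n) = (((k : ℤ) - n : ℤ) : ℂ) := by push_cast; rfl
  rw [h1, Complex.norm_intCast] at hb
  have h2 : |(k : ℤ) - n| < 1 := by exact_mod_cast hb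
  have h3 := Int.abs_lt_one_iff.1 h2
  apply hz
  rw [Set.mem_singleton_iff, hk, Nat.cast_inj]
  omega

/-- The pole at `0` comes from `1/z`, the pole at `j + 1` from the `j`-th term of `halfDigamma`. -/
theorem exists_polyPsi_eq_pole (i n : ℕ) : ∃ g : ℂ → ℂ, AnalyticAt ℂ g n ∧
    ∀ᶠ z in 𝓝[≠] (n : ℂ), polyPsi i z = 1 / (z - n) ^ (i + 1) + g z := by
  rcases n with _ | j
  · refine ⟨fun z => (-1) ^ i * (iteratedDeriv i halfDigamma (z - 1 / 2) / i.factorial), ?_, ?_⟩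
    · have h := analyticAt_iteratedDeriv
        (analyticAt_halfDigamma_of_re_lt (u := 0 - 1 / 2) (by norm_num)) i
      have h2 : AnalyticAt ℂ (fun z => iteratedDeriv i halfDigamma (z - 1 / 2)) (0 : ℕ) :=
        AnalyticAt.comp_of_eq (f := fun z : ℂ => z - 1 / 2) h (by fun_prop) (by simp)
      exact analyticAt_const.mul h2.div_const
    · filter_upwards [eventually_ne_nat 0] with z hz
      rw [polyPsi_eq i hz]
      simp
  · obtain ⟨G, hG, hL⟩ := exists_analyticAt_add_pole j
    refine ⟨fun z => 1 / z ^ (i + 1) + (-1) ^ i * (iteratedDeriv i G (z - 1 / 2) / i.factorial),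
      ?_, ?_⟩
    · have h2 : AnalyticAt ℂ (fun z => iteratedDeriv i G (z - 1 / 2)) ((j + 1 : ℕ) : ℂ) :=
        AnalyticAt.comp_of_eq (f := fun z : ℂ => z - 1 / 2) (analyticAt_iteratedDeriv hG i)
          (by fun_prop) (by push_cast; ring)
      have h3 : (((j + 1 : ℕ) : ℂ)) ^ (i + 1) ≠ 0 := pow_ne_zero _ (Nat.cast_ne_zero.2 j.succ_ne_zero)
      exact AnalyticAt.add (by fun_prop (disch := assumption))
        (analyticAt_const.mul h2.div_const)
    · have hGe : ∀ᶠ z in 𝓝 ((j + 1 : ℕ) : ℂ), AnalyticAt ℂ G (z - 1 / 2) := by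
        have hc : Tendsto (fun z : ℂ => z - 1 / 2) (𝓝 ((j + 1 : ℕ) : ℂ))
            (𝓝 ((j : ℂ) + 1 / 2)) := by
          have : ((j + 1 : ℕ) : ℂ) - 1 / 2 = j + 1 / 2 := by push_cast; ring
          rw [← this]
          exact (continuous_id.sub continuous_const).tendsto _
        exact hc.eventually hG.eventually_analyticAt
      filter_upwards [eventually_ne_nat (j + 1), mem_nhdsWithin_of_mem_nhds hGe,
        self_mem_nhdsWithin] with z hz hGz hzn
      have hne : (j : ℂ) + 1 / 2 - (z - 1 / 2) ≠ 0 := half_sub_sub_half_ne_zero hz j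
      have hp : AnalyticAt ℂ (fun u : ℂ => 1 / ((j : ℂ) + 1 / 2 - u)) (z - 1 / 2) := by
        fun_prop (disch := assumption)
      have h5 : (i.factorial : ℂ) ≠ 0 := Nat.cast_ne_zero.2 i.factorial_ne_zero
      rw [polyPsi_eq i hz, show halfDigamma = G - fun u : ℂ => 1 / ((j : ℂ) + 1 / 2 - u) from
        funext hL, iteratedDeriv_sub hGz.contDiffAt hp.contDiffAt, iteratedDeriv_one_div_const_sub,
        show (j : ℂ) + 1 / 2 - (z - 1 / 2) = -(z - (j + 1 : ℕ)) by push_cast; ring,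
        neg_pow (z - _), sub_div, div_div, mul_comm ((-1) ^ (i + 1) * _) (i.factorial : ℂ),
        ← div_div (i.factorial : ℂ), div_self h5, div_mul_eq_div_div]
      rcases neg_one_pow_eq_or ℂ i with h | h <;> rw [pow_succ (-1 : ℂ), h] <;> ring

/-! ### Residues of the integrand -/

theorem integrand_eq (i : ℕ) (r : RatFunc ℂ) (z : ℂ) : integrand (i + 1) r z =
    π * Complex.tan (π * z) * ratVal r z * polyPsi i z := by
  simp only [integrand, polyPsi, Nat.add_sub_cancel]
  ring

theorem ratVal_eq (r : RatFunc ℂ) (z : ℂ) : ratVal r z = r.num.eval z / r.denom.eval z := by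
  rw [ratVal, RatFunc.eval, Polynomial.eval₂_id, Polynomial.eval₂_id]

theorem mem_ratPoles {r : RatFunc ℂ} {z : ℂ} : z ∈ ratPoles r ↔ r.denom.eval z = 0 := by
  rw [ratPoles, Multiset.mem_toFinset, Polynomial.mem_roots r.denom_ne_zero, Polynomial.IsRoot]

theorem analyticAt_polynomial_eval (P : Polynomial ℂ) (z : ℂ) :
    AnalyticAt ℂ (fun z => P.eval z) z :=
  P.differentiable.analyticAt z

theorem analyticAt_ratVal {r : RatFunc ℂ} {z : ℂ} (hz : z ∉ ratPoles r) :
    AnalyticAt ℂ (ratVal r) z := by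
  rw [funext (ratVal_eq r)]
  exact (analyticAt_polynomial_eval _ z).div (analyticAt_polynomial_eval _ z)
    fun h => hz (mem_ratPoles.2 h)

theorem meromorphicAt_ratVal (r : RatFunc ℂ) (z : ℂ) : MeromorphicAt (ratVal r) z := by
  rw [funext (ratVal_eq r)]
  exact (analyticAt_polynomial_eval _ z).meromorphicAt.div
    (analyticAt_polynomial_eval _ z).meromorphicAt

theorem meromorphicAt_pi_tan (z : ℂ) :
    MeromorphicAt (fun z : ℂ => π * Complex.tan (π * z)) z := by
  simp only [Complex.tan_eq_sin_div_cos]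
  have h1 : AnalyticAt ℂ (fun z : ℂ => Complex.sin (π * z)) z := by fun_prop
  have h2 : AnalyticAt ℂ (fun z : ℂ => Complex.cos (π * z)) z := by fun_prop
  exact (MeromorphicAt.const _ _).mul (h1.meromorphicAt.div h2.meromorphicAt)

theorem analyticAt_pi_tan {z : ℂ} (hz : Complex.cos (π * z) ≠ 0) :
    AnalyticAt ℂ (fun z : ℂ => π * Complex.tan (π * z)) z := by
  simp only [Complex.tan_eq_sin_div_cos]
  fun_prop (disch := assumption)

theorem cos_pi_nat_ne_zero (n : ℕ) : Complex.cos (π * (n : ℂ)) ≠ 0 := by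
  intro h
  have h1 := Complex.sin_sq_add_cos_sq (π * (n : ℂ))
  rw [h, mul_comm, Complex.sin_nat_mul_pi] at h1
  norm_num at h1

theorem meromorphicAt_polyPsi (i n : ℕ) : MeromorphicAt (polyPsi i) n := by
  obtain ⟨g, hg, h⟩ := exists_polyPsi_eq_pole i n
  refine MeromorphicAt.congr (f := fun z => 1 / (z - n) ^ (i + 1) + g z) ?_
    (h.mono fun z hz => hz.symm)
  exact MeromorphicAt.add (by fun_prop) hg.meromorphicAt

theorem meromorphicAt_integrand (i : ℕ) (r : RatFunc ℂ) (z : ℂ) :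
    MeromorphicAt (integrand (i + 1) r) z := by
  rw [funext (integrand_eq i r)]
  refine ((meromorphicAt_pi_tan z).mul (meromorphicAt_ratVal r z)).mul ?_
  by_cases h : ∃ k : ℕ, z = k
  · obtain ⟨k, rfl⟩ := h
    exact meromorphicAt_polyPsi i k
  · exact (analyticAt_polyPsi i (not_exists.1 h)).meromorphicAt

theorem differentiableAt_integrand (i : ℕ) {r : RatFunc ℂ} {z : ℂ} (h1 : z ∉ ratPoles r)
    (h2 : Complex.cos (π * z) ≠ 0) (h3 : ∀ k : ℕ, z ≠ k) :
    DifferentiableAt ℂ (integrand (i + 1) r) z := by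
  rw [funext (integrand_eq i r)]
  exact (((analyticAt_pi_tan h2).mul (analyticAt_ratVal h1)).mul
    (analyticAt_polyPsi i h3)).differentiableAt

/-- Writing `cos (πz) = (z - c) D(z)` with `D(c) = -π sin (πc)` shows that `π tan (πz)` has residue
`-1`. -/
theorem residue_integrand_of_cos_eq_zero (i : ℕ) {r : RatFunc ℂ} {c : ℂ} (h1 : c ∉ ratPoles r)
    (h2 : Complex.cos (π * c) = 0) (h3 : ∀ k : ℕ, c ≠ k) :
    residue (integrand (i + 1) r) c = -(polyPsi i c * ratVal r c) := by
  set D := dslope (fun z : ℂ => Complex.cos (π * z)) c with hD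
  have hs : Complex.sin (π * c) ≠ 0 := by
    intro h
    have := Complex.sin_sq_add_cos_sq (π * c)
    rw [h, h2] at this
    norm_num at this
  have hDc : D c = -(Complex.sin (π * c) * π) := by
    rw [hD, dslope_same]
    have h4 : HasDerivAt (fun z : ℂ => (π : ℂ) * z) π c := by
      simpa using (hasDerivAt_id c).const_mul (π : ℂ)
    rw [h4.ccos.deriv, neg_mul]
  have hDc0 : D c ≠ 0 := by
    rw [hDc]
    exact neg_ne_zero.2 (mul_ne_zero hs (Complex.ofReal_ne_zero.2 Real.pi_ne_zero))
  have hDan : AnalyticAt ℂ D c := by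
    have h4 : AnalyticAt ℂ (fun z : ℂ => Complex.cos (π * z)) c := by fun_prop
    obtain ⟨p, hp⟩ := h4
    exact ⟨_, hp.has_fpower_series_dslope_fslope⟩
  have hH : AnalyticAt ℂ
      (fun z => π * Complex.sin (π * z) / D z * ratVal r z * polyPsi i z) c := by
    refine (AnalyticAt.mul (AnalyticAt.div ?_ hDan hDc0) (analyticAt_ratVal h1)).mul
      (analyticAt_polyPsi i h3)
    fun_prop
  rw [residue_eq_of_pole 0 hH (analyticAt_const (v := 0)), iteratedDeriv_zero, hDc]
  · have := Complex.ofReal_ne_zero.2 Real.pi_ne_zero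
    simp
    field_simp
  · filter_upwards [self_mem_nhdsWithin] with z hz
    have h4 := sub_smul_dslope (fun z : ℂ => Complex.cos (π * z)) c z
    simp only [h2, smul_eq_mul, sub_zero] at h4
    rw [integrand_eq, Complex.tan_eq_sin_div_cos, ← h4, zero_add, pow_one, add_zero,
      div_mul_eq_div_div]
    ring

theorem sum_range_odd (F : ℕ → ℂ) (i : ℕ) :
    ∑ j ∈ Finset.range (i + 1), (1 - (-1) ^ j) * F (j + 1) =
      2 * ∑ k ∈ Finset.Icc 1 ((i + 1) / 2), F (2 * k) := by
  induction i with
  | zero => simp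
  | succ i ih =>
    rw [Finset.sum_range_succ, ih]
    rcases Nat.even_or_odd' i with ⟨m, rfl | rfl⟩
    · rw [show (2 * m + 1 + 1) / 2 = m + 1 by omega, show (2 * m + 1) / 2 = m by omega,
        Finset.sum_Icc_succ_top (by omega), pow_succ, pow_mul]
      norm_num
      rw [show 2 * (m + 1) = 2 * m + 1 + 1 by ring]
      ring
    · rw [show (2 * m + 1 + 1 + 1) / 2 = m + 1 by omega, show (2 * m + 1 + 1) / 2 = m + 1 by omega,
        show 2 * m + 1 + 1 = 2 * (m + 1) by ring, pow_mul]
      simp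

/-- Leibniz's rule for the Taylor coefficient of order `i` of `π tan (πz) r(z)`; only odd orders `2k
- 1` of the tangent survive. -/
theorem residue_integrand_nat (i : ℕ) {r : RatFunc ℂ} (n : ℕ) (hn : (n : ℂ) ∉ ratPoles r) :
    residue (integrand (i + 1) r) n = 2 * ∑ k ∈ Finset.Icc 1 ((i + 1) / 2),
      tTilde (2 * k) / ((i + 1 - 2 * k).factorial : ℂ) *
        iteratedDeriv (i + 1 - 2 * k) (ratVal r) n := by
  obtain ⟨g, hg, hP⟩ := exists_polyPsi_eq_pole i n
  have ht := analyticAt_pi_tan (cos_pi_nat_ne_zero n)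
  have hr := analyticAt_ratVal hn
  rw [residue_eq_of_pole i (ht.mul hr) ((ht.mul hr).mul hg),
    iteratedDeriv_mul ht.contDiffAt hr.contDiffAt, Finset.sum_div,
    ← sum_range_odd (fun m => tTilde m / ((i + 1 - m).factorial : ℂ) *
        iteratedDeriv (i + 1 - m) (ratVal r) n)]
  · refine Finset.sum_congr rfl fun j hj => ?_
    have hj' : j ≤ i := Nat.lt_succ_iff.1 (Finset.mem_range.1 hj)
    have h1 := iteratedDeriv_pi_tan_nat j n
    have hjf : (j.factorial : ℂ) ≠ 0 := Nat.cast_ne_zero.2 j.factorial_ne_zero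
    have hif : (i.factorial : ℂ) ≠ 0 := Nat.cast_ne_zero.2 i.factorial_ne_zero
    have hijf : ((i - j).factorial : ℂ) ≠ 0 := Nat.cast_ne_zero.2 (i - j).factorial_ne_zero
    rw [div_eq_iff hjf] at h1
    rw [h1, Nat.cast_choose ℂ hj', Nat.add_sub_add_right]
    field_simp
  · filter_upwards [hP] with z hz
    rw [integrand_eq, hz]
    simp only [Pi.mul_apply]
    ring

/-! ### Absolute convergence of the series -/

theorem exists_norm_ratVal_le {r : RatFunc ℂ}
    (hr : Asymptotics.IsBigO (Bornology.cobounded ℂ) (ratVal r) (fun z : ℂ => z ^ (-2 : ℤ))) :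
    ∃ C M : ℝ, 0 < C ∧ 0 < M ∧ (∀ z ∈ ratPoles r, ‖z‖ < M) ∧
      ∀ z : ℂ, M ≤ ‖z‖ → ‖ratVal r z‖ ≤ C / ‖z‖ ^ 2 := by
  obtain ⟨C, hC, h⟩ := hr.exists_pos
  obtain ⟨M, -, hM⟩ := (hasBasis_cobounded_norm (E := ℂ)).eventually_iff.1 h.bound
  obtain ⟨M', hM'⟩ := ((ratPoles r).finite_toSet.image norm).bddAbove
  refine ⟨C, max M (max (M' + 1) 1), hC, by positivity, fun z hz => ?_, fun z hz => ?_⟩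
  · have := hM' ⟨z, hz, rfl⟩
    exact lt_max_of_lt_right (lt_max_of_lt_left (by linarith))
  · have := hM (x := z) ((le_max_left _ _).trans hz)
    refine this.trans_eq ?_
    rw [norm_zpow, zpow_neg, div_eq_mul_inv]
    norm_cast

theorem exists_norm_oddHarmonic_le {p : ℕ} (hp : 1 ≤ p) :
    ∃ K : ℝ, 0 ≤ K ∧ ∀ n : ℕ, ‖oddHarmonic p n‖ ≤ K * ((n : ℝ) + 1) ^ (1 / 2 : ℝ) := by
  -- `2 ^ p` comes from `k - 1/2 ≥ k/2`, and `3` from `1 + log x ≤ 1 + 2√x ≤ 3√x` for `x ≥ 1`.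
  refine ⟨2 ^ p * 3, by positivity, fun n => ?_⟩
  have h1 : ‖oddHarmonic p n‖ ≤ 2 ^ p * (harmonic n : ℝ) := by
    rw [harmonic_eq_sum_Icc, oddHarmonic, Rat.cast_sum, Finset.mul_sum]
    refine norm_sum_le_of_le _ fun k hk => ?_
    have hk1 : (1 : ℝ) ≤ k := by exact_mod_cast (Finset.mem_Icc.1 hk).1
    have h2 : ‖(k : ℂ) - 1 / 2‖ = (k : ℝ) - 1 / 2 := by
      have : (k : ℂ) - 1 / 2 = (((k : ℝ) - 1 / 2 : ℝ) : ℂ) := by push_cast; rfl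
      rw [this, Complex.norm_real, Real.norm_of_nonneg (by linarith)]
    rw [norm_div, norm_pow, h2, norm_one]
    have h3 : (k : ℝ) / 2 ^ p ≤ ((k : ℝ) - 1 / 2) ^ p := by
      calc (k : ℝ) / 2 ^ p ≤ (k : ℝ) ^ p / 2 ^ p := by
            gcongr; exact le_self_pow₀ hk1 (by omega)
        _ = ((k : ℝ) / 2) ^ p := (div_pow _ _ _).symm
        _ ≤ _ := by gcongr; linarith
    refine (one_div_le_one_div_of_le (by positivity) h3).trans_eq ?_
    push_cast
    field_simp
  have h4 : (harmonic n : ℝ) ≤ 3 * ((n : ℝ) + 1) ^ (1 / 2 : ℝ) := by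
    have h5 := harmonic_le_one_add_log n
    have h6 : Real.log n ≤ Real.log (n + 1) := by
      rcases Nat.eq_zero_or_pos n with rfl | hn
      · simp
      · exact Real.log_le_log (by exact_mod_cast hn) (by linarith)
    have h7 := Real.log_le_rpow_div (x := (n : ℝ) + 1) (ε := 1 / 2) (by positivity) (by norm_num)
    have h8 : 1 ≤ ((n : ℝ) + 1) ^ (1 / 2 : ℝ) :=
      Real.one_le_rpow (by linarith [(n.cast_nonneg : (0 : ℝ) ≤ n)]) (by norm_num)
    linarith
  calc ‖oddHarmonic p n‖ ≤ 2 ^ p * (harmonic n : ℝ) := h1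
    _ ≤ 2 ^ p * (3 * ((n : ℝ) + 1) ^ (1 / 2 : ℝ)) := by gcongr
    _ = _ := by ring

theorem summable_mul_of_bounds {a b : ℕ → ℂ} {K C : ℝ} (hK : 0 ≤ K) (hC : 0 ≤ C)
    (ha : ∀ n, ‖a n‖ ≤ K * ((n : ℝ) + 1) ^ (1 / 2 : ℝ))
    (hb : ∀ᶠ n : ℕ in atTop, ‖b n‖ ≤ C / ((n : ℝ) + 1 / 2) ^ 2) :
    Summable fun n => a n * b n := by
  have hs : Summable fun n : ℕ => K * (4 * C) * ((n + 1 : ℕ) : ℝ) ^ (-(3 / 2) : ℝ) :=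
    ((summable_nat_add_iff 1).2
      (Real.summable_nat_rpow.2 (by norm_num : (-(3 / 2) : ℝ) < -1))).mul_left _
  refine Summable.of_norm_bounded_eventually_nat hs ?_
  filter_upwards [hb] with n hn
  have hpos : (0 : ℝ) < (n : ℝ) + 1 := by positivity
  have h1 : C / ((n : ℝ) + 1 / 2) ^ 2 ≤ 4 * C * ((n : ℝ) + 1) ^ (-2 : ℝ) := by
    rw [Real.rpow_neg hpos.le, ← div_eq_mul_inv, Real.rpow_two,
      div_le_div_iff₀ (by positivity) (by positivity)]
    have : ((n : ℝ) + 1) ^ 2 ≤ 4 * ((n : ℝ) + 1 / 2) ^ 2 := by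
      nlinarith [(n.cast_nonneg : (0 : ℝ) ≤ n)]
    nlinarith
  have h2 : ((n : ℝ) + 1) ^ (-(3 / 2) : ℝ) =
      ((n : ℝ) + 1) ^ (1 / 2 : ℝ) * ((n : ℝ) + 1) ^ (-2 : ℝ) := by
    rw [← Real.rpow_add hpos]; norm_num
  push_cast
  rw [norm_mul, h2]
  calc ‖a n‖ * ‖b n‖ ≤ (K * ((n : ℝ) + 1) ^ (1 / 2 : ℝ)) *
        (4 * C * ((n : ℝ) + 1) ^ (-2 : ℝ)) :=
      mul_le_mul (ha n) (hn.trans h1) (norm_nonneg _) (by positivity)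
    _ = _ := by ring

/-- Cauchy's estimate on the unit disc about `n`, where `|z| ≥ n - 1 ≥ n/2`, keeps the decay `n⁻²`.
-/
theorem summable_iteratedDeriv_ratVal {r : RatFunc ℂ}
    (hr : Asymptotics.IsBigO (Bornology.cobounded ℂ) (ratVal r) (fun z : ℂ => z ^ (-2 : ℤ)))
    (m : ℕ) : Summable fun n : ℕ => iteratedDeriv m (ratVal r) (n : ℂ) := by
  obtain ⟨C, M, hC, hM, hpole, hbound⟩ := exists_norm_ratVal_le hr
  refine Summable.of_norm_bounded_eventually_nat
    ((Real.summable_nat_pow_inv.2 one_lt_two).mul_left (m.factorial * (4 * C))) ?_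
  filter_upwards [eventually_ge_atTop ⌈M + 1⌉₊, eventually_ge_atTop 2] with n hn hn2
  have hn' : M + 1 ≤ n := Nat.ceil_le.1 hn
  have hn2' : (2 : ℝ) ≤ n := by exact_mod_cast hn2
  have hball : ∀ z ∈ closedBall (n : ℂ) 1, (n : ℝ) - 1 ≤ ‖z‖ := by
    intro z hz
    rw [mem_closedBall, dist_eq_norm, norm_sub_rev] at hz
    have := norm_sub_norm_le (n : ℂ) z
    rw [Complex.norm_natCast] at this
    linarith
  have h := norm_iteratedDeriv_le_of_forall_mem_sphere_norm_le (c := (n : ℂ)) (R := 1)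
    (C := 4 * C / (n : ℝ) ^ 2) (f := ratVal r) m one_pos ?_ ?_
  · refine h.trans_eq ?_
    rw [one_pow, div_one]; ring
  · apply DifferentiableOn.diffContOnCl
    rw [closure_ball _ one_ne_zero]
    intro z hz
    refine (analyticAt_ratVal fun hp => ?_).differentiableAt.differentiableWithinAt
    linarith [hpole z hp, hball z hz]
  · intro z hz
    have h1 := hball z (sphere_subset_closedBall hz)
    refine (hbound z (by linarith)).trans ?_
    rw [div_le_div_iff₀ (by nlinarith) (by positivity)]
    have : (n : ℝ) ≤ 2 * ‖z‖ := by linarith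
    have : (n : ℝ) ^ 2 ≤ (2 * ‖z‖) ^ 2 := by gcongr
    nlinarith

/-! ### Vanishing of the contour integral -/

theorem norm_polyPsi_le (i : ℕ) {ε : ℝ} (hε : 0 < ε) :
    ∀ᶠ N : ℕ in atTop, ∀ z ∈ sphere (0 : ℂ) (N + 1 / 4), ‖polyPsi i z‖ ≤ ε * N := by
  filter_upwards [norm_iteratedDeriv_halfDigamma_le i (half_pos hε), eventually_ge_atTop 1,
    eventually_ge_atTop ⌈2 / ε⌉₊] with N hN hN1 hNε z hz
  have hz' : ‖z‖ = N + 1 / 4 := by simpa using hz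
  have hN1' : (1 : ℝ) ≤ N := by exact_mod_cast hN1
  have h1 : 1 ≤ ε / 2 * N := by
    have := Nat.ceil_le.1 hNε
    rw [div_le_iff₀ hε] at this
    linarith
  have hann : z ∈ annulus N := mem_annulus.2 (by rw [hz']; norm_num)
  rw [polyPsi_eq i fun k => by exact_mod_cast ne_int_of_mem_annulus hN1 hann k]
  refine (norm_add_le _ _).trans ?_
  have h2 : ‖1 / z ^ (i + 1)‖ ≤ 1 := by
    rw [norm_div, norm_one, norm_pow, hz']
    exact div_le_one_of_le₀ (one_le_pow₀ (by linarith)) (by positivity)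
  have h3 := hN z hz
  rw [norm_mul, norm_pow, norm_neg, norm_one, one_pow, one_mul]
  linarith

theorem tendsto_circleIntegral_integrand (i : ℕ) {r : RatFunc ℂ}
    (hr : Asymptotics.IsBigO (Bornology.cobounded ℂ) (ratVal r) (fun z : ℂ => z ^ (-2 : ℤ))) :
    Tendsto (fun N : ℕ => circleIntegral (integrand (i + 1) r) 0 (N + 1 / 4)) atTop (𝓝 0) := by
  obtain ⟨C, M, hC, hM, -, hbound⟩ := exists_norm_ratVal_le hr
  have hB := tanBound_pos
  rw [Metric.tendsto_nhds]
  intro δ hδ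
  -- `A` collects the constants, so that the final bound is `(δ/2)(N/R)`.
  set A : ℝ := 2 * π * (π * tanBound * C) with hA
  have hApos : 0 < A := by positivity
  filter_upwards [norm_polyPsi_le i (ε := δ / (2 * A)) (by positivity), eventually_ge_atTop 1,
    eventually_ge_atTop ⌈M⌉₊] with N hN hN1 hNM
  have hN1' : (1 : ℝ) ≤ N := by exact_mod_cast hN1
  set R : ℝ := N + 1 / 4 with hR
  have hRpos : 0 < R := by positivity
  have hint : ‖circleIntegral (integrand (i + 1) r) 0 R‖ ≤
      2 * π * R * (π * tanBound * (C / R ^ 2) * (δ / (2 * A) * N)) := by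
    refine circleIntegral.norm_integral_le_of_norm_le_const hRpos.le fun z hz => ?_
    have hz' : ‖z‖ = R := by simpa using hz
    have hann : z ∈ annulus N := mem_annulus.2 (by rw [hz', hR]; norm_num)
    rw [integrand_eq, norm_mul, norm_mul, norm_mul, Complex.norm_real,
      Real.norm_of_nonneg Real.pi_pos.le]
    have h1 := norm_tan_le hN1 hann
    have h2 := hbound z (by rw [hz', hR]; linarith [Nat.ceil_le.1 hNM])
    rw [hz'] at h2
    have h3 := hN z hz
    gcongr
  rw [dist_zero_right]
  refine hint.trans_lt ?_
  have h4 : 2 * π * R * (π * tanBound * (C / R ^ 2) * (δ / (2 * A) * N)) =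
      δ / 2 * (N / R) := by
    rw [hA]
    field_simp
  rw [h4]
  have h5 : (N : ℝ) / R ≤ 1 := div_le_one_of_le₀ (by linarith) hRpos.le
  nlinarith

/-! ### Residue sum inside the circle of radius `N + 1/4` -/

/-- The half-integers `n + 1/2` with `n < N`. -/
def posHalves (N : ℕ) : Finset ℂ := (Finset.range N).image fun n : ℕ => (n : ℂ) + 1 / 2
/-- The half-integers `-(n + 1/2)` with `n < N`. -/
def negHalves (N : ℕ) : Finset ℂ := (Finset.range N).image fun n : ℕ => -((n : ℂ) + 1 / 2)
/-- The integers `0, …, N`. -/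
def natsUpTo (N : ℕ) : Finset ℂ := (Finset.range (N + 1)).image fun n : ℕ => (n : ℂ)

theorem cos_pi_mul_eq_zero_iff {z : ℂ} : Complex.cos (π * z) = 0 ↔
    (∃ n : ℕ, z = (n : ℂ) + 1 / 2) ∨ ∃ n : ℕ, z = -((n : ℂ) + 1 / 2) := by
  have hpi := Complex.ofReal_ne_zero.2 Real.pi_ne_zero
  have h0 : Complex.cos (π * z) = 0 ↔ ∃ k : ℤ, z = k + 1 / 2 := by
    rw [Complex.cos_eq_zero_iff]
    refine exists_congr fun k => ⟨fun h => ?_, fun h => ?_⟩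
    · apply mul_left_cancel₀ hpi
      rw [h]; ring
    · rw [h]; ring
  rw [h0]
  constructor
  · rintro ⟨k, rfl⟩
    rcases k with n | n
    · exact Or.inl ⟨n, by simp⟩
    · refine Or.inr ⟨n, ?_⟩
      rw [Int.cast_negSucc]
      push_cast
      ring
  · rintro (⟨n, rfl⟩ | ⟨n, rfl⟩)
    · exact ⟨n, by push_cast; rfl⟩
    · exact ⟨-(n : ℤ) - 1, by push_cast; ring⟩

theorem circleIntegral_integrand_eq (i : ℕ) {r : RatFunc ℂ} {N : ℕ}
    (h0 : (0 : ℂ) ∉ ratPoles r)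
    (hn : ∀ n : ℕ, 1 ≤ n → (n : ℂ) ∉ ratPoles r ∧ (n : ℂ) - 1 / 2 ∉ ratPoles r ∧
      -((n : ℂ) - 1 / 2) ∉ ratPoles r)
    (hN : ∀ z ∈ ratPoles r, ‖z‖ < N) :
    circleIntegral (integrand (i + 1) r) 0 (N + 1 / 4) = 2 * π * I *
      (∑ β ∈ ratPoles r, residue (integrand (i + 1) r) β
        + ∑ n ∈ Finset.range N, -(((-1) ^ (i + 1) * tTilde (i + 1) + oddHarmonic (i + 1) (n + 1)) *
            ratVal r (((n : ℂ) + 1) - 1 / 2))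
        + ∑ n ∈ Finset.range N, -((-1) ^ (i + 1) * ((tTilde (i + 1) - oddHarmonic (i + 1) n) *
            ratVal r (1 / 2 - ((n : ℂ) + 1))))
        + ∑ n ∈ Finset.range (N + 1), 2 * ∑ k ∈ Finset.Icc 1 ((i + 1) / 2),
            tTilde (2 * k) / ((i + 1 - 2 * k).factorial : ℂ) *
              iteratedDeriv (i + 1 - 2 * k) (ratVal r) n) := by
  have hpos : ∀ n : ℕ, (n : ℂ) + 1 / 2 ∉ ratPoles r := fun n => by
    have := (hn (n + 1) (by omega)).2.1
    rwa [Nat.cast_succ, add_sub_assoc, show (1 : ℂ) - 1 / 2 = 1 / 2 by norm_num] at this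
  have hneg : ∀ n : ℕ, -((n : ℂ) + 1 / 2) ∉ ratPoles r := fun n => by
    have := (hn (n + 1) (by omega)).2.2
    rwa [Nat.cast_succ, add_sub_assoc, show (1 : ℂ) - 1 / 2 = 1 / 2 by norm_num] at this
  have hnat : ∀ n : ℕ, (n : ℂ) ∉ ratPoles r := fun n => by
    rcases Nat.eq_zero_or_pos n with rfl | h
    · simpa using h0
    · exact (hn n h).1
  have hd1 : Disjoint (ratPoles r) (posHalves N) := by
    rw [Finset.disjoint_right]
    intro z hz
    obtain ⟨n, -, rfl⟩ := Finset.mem_image.1 hz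
    exact hpos n
  have hd2 : Disjoint (ratPoles r ∪ posHalves N) (negHalves N) := by
    rw [Finset.disjoint_right]
    intro z hz
    obtain ⟨n, -, rfl⟩ := Finset.mem_image.1 hz
    rw [Finset.mem_union, not_or]
    refine ⟨hneg n, fun h => ?_⟩
    obtain ⟨m, -, hm⟩ := Finset.mem_image.1 h
    have h1 : ((m + n + 1 : ℕ) : ℂ) = 0 := by push_cast; linear_combination hm
    exact absurd (Nat.cast_eq_zero.1 h1) (by omega)
  have hd3 : Disjoint (ratPoles r ∪ posHalves N ∪ negHalves N) (natsUpTo N) := by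
    rw [Finset.disjoint_right]
    intro z hz
    obtain ⟨n, -, rfl⟩ := Finset.mem_image.1 hz
    rw [Finset.mem_union, Finset.mem_union, not_or, not_or]
    refine ⟨⟨hnat n, fun h => ?_⟩, fun h => ?_⟩
    · obtain ⟨m, -, hm⟩ := Finset.mem_image.1 h
      exact half_add_ne_nat m n hm
    · obtain ⟨m, -, hm⟩ := Finset.mem_image.1 h
      exact neg_half_add_ne_nat m n hm
  have hres1 : ∀ n : ℕ, residue (integrand (i + 1) r) ((n : ℂ) + 1 / 2) =
      -(((-1) ^ (i + 1) * tTilde (i + 1) + oddHarmonic (i + 1) (n + 1)) *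
        ratVal r (((n : ℂ) + 1) - 1 / 2)) := fun n => by
    rw [residue_integrand_of_cos_eq_zero i (hpos n)
      (cos_pi_mul_eq_zero_iff.2 (Or.inl ⟨n, rfl⟩)) (half_add_ne_nat n), polyPsi_half,
      show (n : ℂ) + 1 - 1 / 2 = n + 1 / 2 by ring]
  have hres2 : ∀ n : ℕ, residue (integrand (i + 1) r) (-((n : ℂ) + 1 / 2)) =
      -((-1) ^ (i + 1) * ((tTilde (i + 1) - oddHarmonic (i + 1) n) *
        ratVal r (1 / 2 - ((n : ℂ) + 1)))) := fun n => by
    rw [residue_integrand_of_cos_eq_zero i (hneg n)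
      (cos_pi_mul_eq_zero_iff.2 (Or.inr ⟨n, rfl⟩)) (neg_half_add_ne_nat n), polyPsi_neg_half,
      mul_assoc, show (1 : ℂ) / 2 - (n + 1) = -(n + 1 / 2) by ring]
  have hres3 := fun n : ℕ => residue_integrand_nat i n (hnat n)
  rw [circleIntegral_eq_sum_residue (by positivity)
    (ratPoles r ∪ posHalves N ∪ negHalves N ∪ natsUpTo N) _ ?_
    (fun z _ => meromorphicAt_integrand i r z) ?_, Finset.sum_union hd3, Finset.sum_union hd2,
    Finset.sum_union hd1, posHalves, negHalves, natsUpTo, Finset.sum_image, Finset.sum_image,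
    Finset.sum_image]
  · simp only [hres1, hres2, hres3]
  · intro a _ b _ h
    simpa using h
  · intro a _ b _ h
    simpa using h
  · intro a _ b _ h
    simpa using h
  · intro z hz
    rw [mem_ball_zero_iff]
    simp only [Finset.mem_union, posHalves, negHalves, natsUpTo, Finset.mem_image,
      Finset.mem_range] at hz
    rcases hz with ((hz | ⟨n, hnN, rfl⟩) | ⟨n, hnN, rfl⟩) | ⟨n, hnN, rfl⟩
    · linarith [hN z hz]
    · rw [half_norm]
      have : (n : ℝ) + 1 ≤ N := by exact_mod_cast hnN
      linarith
    · rw [norm_neg, half_norm]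
      have : (n : ℝ) + 1 ≤ N := by exact_mod_cast hnN
      linarith
    · rw [Complex.norm_natCast]
      have : (n : ℝ) ≤ N := by exact_mod_cast Nat.lt_succ_iff.1 hnN
      linarith
  · intro z hz hzT
    rw [mem_closedBall_zero_iff] at hz
    simp only [Finset.mem_union, posHalves, negHalves, natsUpTo, Finset.mem_image,
      Finset.mem_range, not_or, not_exists, not_and] at hzT
    obtain ⟨⟨⟨h1, h2⟩, h3⟩, h4⟩ := hzT
    -- The radius `N + 1/4` separates the integer `N` from the half-integer `N + 1/2`.
    have hhalf : ∀ n : ℕ, (n : ℝ) + 1 / 2 ≤ N + 1 / 4 → n < N := fun n h => by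
      have : (n : ℝ) < N := by linarith
      exact_mod_cast this
    refine differentiableAt_integrand i h1 (fun hc => ?_) (fun k hk => ?_)
    · rcases cos_pi_mul_eq_zero_iff.1 hc with ⟨n, rfl⟩ | ⟨n, rfl⟩
      · rw [half_norm] at hz
        exact h2 n (hhalf n hz) rfl
      · rw [norm_neg, half_norm] at hz
        exact h3 n (hhalf n hz) rfl
    · rw [hk, Complex.norm_natCast] at hz
      refine h4 k ?_ hk.symm
      have : (k : ℝ) < (N + 1 : ℕ) := by push_cast; linarith
      exact_mod_cast this

end OddEuler
end

/-! ### The identity -/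

theorem theorem3p7 (p : ℕ) (hp : 1 ≤ p) (r : RatFunc ℂ)
    (hr : Asymptotics.IsBigO (Bornology.cobounded ℂ) (OddEuler.ratVal r)
      (fun z : ℂ => z ^ (-2 : ℤ)))
    (h0 : (0 : ℂ) ∉ OddEuler.ratPoles r)
    (hn : ∀ n : ℕ, 1 ≤ n →
      (n : ℂ) ∉ OddEuler.ratPoles r ∧
      (n : ℂ) - 1 / 2 ∉ OddEuler.ratPoles r ∧
      -((n : ℂ) - 1 / 2) ∉ OddEuler.ratPoles r) :
    Summable (fun n : ℕ =>
      ((-1) ^ p * OddEuler.tTilde p + OddEuler.oddHarmonic p (n + 1)) *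
        OddEuler.ratVal r (((n : ℂ) + 1) - 1 / 2)) ∧
    Summable (fun n : ℕ =>
      (OddEuler.tTilde p - OddEuler.oddHarmonic p n) *
        OddEuler.ratVal r (1 / 2 - ((n : ℂ) + 1))) ∧
    (∀ k ∈ Finset.Icc 1 (p / 2), Summable (fun n : ℕ =>
      iteratedDeriv (p - 2 * k) (OddEuler.ratVal r) (n : ℂ))) ∧
    -(∑' n : ℕ, ((-1) ^ p * OddEuler.tTilde p + OddEuler.oddHarmonic p (n + 1)) *
          OddEuler.ratVal r (((n : ℂ) + 1) - 1 / 2))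
      - (-1) ^ p * (∑' n : ℕ, (OddEuler.tTilde p - OddEuler.oddHarmonic p n) *
          OddEuler.ratVal r (1 / 2 - ((n : ℂ) + 1)))
      + 2 * (∑ k ∈ Finset.Icc 1 (p / 2),
          OddEuler.tTilde (2 * k) / ((p - 2 * k).factorial : ℂ) *
            ∑' n : ℕ, iteratedDeriv (p - 2 * k) (OddEuler.ratVal r) (n : ℂ))
      + ∑ β ∈ OddEuler.ratPoles r, OddEuler.residue (OddEuler.integrand p r) β = 0 := by
  open OddEuler Filter Topology in
  obtain ⟨C, M, hC, hM, hpole, hbound⟩ := exists_norm_ratVal_le hr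
  obtain ⟨K, hK, hh⟩ := exists_norm_oddHarmonic_le hp
  have hone : ∀ n : ℕ, (1 : ℝ) ≤ ((n : ℝ) + 1) ^ (1 / 2 : ℝ) := fun n =>
    Real.one_le_rpow (by linarith [(n.cast_nonneg : (0 : ℝ) ≤ n)]) (by norm_num)
  have ht : ∀ n : ℕ, ‖tTilde p‖ ≤ ‖tTilde p‖ * ((n : ℝ) + 1) ^ (1 / 2 : ℝ) := fun n =>
    le_mul_of_one_le_right (norm_nonneg _) (hone n)
  have hdecay : ∀ z : ℕ → ℂ, (∀ n, ‖z n‖ = (n : ℝ) + 1 / 2) →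
      ∀ᶠ n : ℕ in atTop, ‖ratVal r (z n)‖ ≤ C / ((n : ℝ) + 1 / 2) ^ 2 := fun z hz => by
    filter_upwards [eventually_ge_atTop ⌈M⌉₊] with n hn
    rw [← hz n]
    exact hbound _ (by rw [hz n]; linarith [Nat.ceil_le.1 hn])
  have hs1 : Summable (fun n : ℕ => ((-1) ^ p * tTilde p + oddHarmonic p (n + 1)) *
      ratVal r (((n : ℂ) + 1) - 1 / 2)) := by
    refine summable_mul_of_bounds (K := ‖tTilde p‖ + 2 * K) (by positivity) hC.le (fun n => ?_)
      (hdecay _ fun n => ?_)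
    · refine (norm_add_le _ _).trans ?_
      have h1 := hh (n + 1)
      -- The index `n + 1` in place of `n` costs at most a factor `2`, hence `2 * K`.
      have h2 : (((n + 1 : ℕ) : ℝ) + 1) ^ (1 / 2 : ℝ) ≤ 2 * ((n : ℝ) + 1) ^ (1 / 2 : ℝ) := by
        have h3 : ((n + 1 : ℕ) : ℝ) + 1 ≤ 4 * ((n : ℝ) + 1) := by
          push_cast
          linarith [(n.cast_nonneg : (0 : ℝ) ≤ n)]
        refine (Real.rpow_le_rpow (by positivity) h3 (by norm_num)).trans_eq ?_
        rw [Real.mul_rpow (by norm_num) (by positivity), ← Real.sqrt_eq_rpow 4,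
          show (4 : ℝ) = 2 ^ 2 by norm_num, Real.sqrt_sq (by norm_num)]
      rw [norm_mul, norm_pow, norm_neg, norm_one, one_pow, one_mul]
      nlinarith [ht n]
    · rw [add_sub_assoc, show (1 : ℂ) - 1 / 2 = 1 / 2 by norm_num, half_norm]
  have hs2 : Summable (fun n : ℕ => (tTilde p - oddHarmonic p n) *
      ratVal r (1 / 2 - ((n : ℂ) + 1))) := by
    refine summable_mul_of_bounds (K := ‖tTilde p‖ + K) (by positivity) hC.le (fun n => ?_)
      (hdecay _ fun n => ?_)
    · refine (norm_sub_le _ _).trans ?_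
      linarith [ht n, hh n]
    · rw [show (1 : ℂ) / 2 - (n + 1) = -(n + 1 / 2) by ring, norm_neg, half_norm]
  have hs3 : ∀ m : ℕ, Summable (fun n : ℕ => iteratedDeriv m (ratVal r) (n : ℂ)) :=
    summable_iteratedDeriv_ratVal hr
  refine ⟨hs1, hs2, fun k _ => hs3 _, ?_⟩
  obtain ⟨i, rfl⟩ : ∃ i, p = i + 1 := ⟨p - 1, by omega⟩
  have hl1 := hs1.hasSum.neg.tendsto_sum_nat
  have hl2 := (hs2.hasSum.mul_left ((-1) ^ (i + 1))).neg.tendsto_sum_nat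
  -- Shifted by one because the circle encloses the `N + 1` integers `0, …, N`.
  have hl3 := (tendsto_add_atTop_iff_nat 1).2 (((hasSum_sum
    fun k (_ : k ∈ Finset.Icc 1 ((i + 1) / 2)) =>
    (hs3 (i + 1 - 2 * k)).hasSum.mul_left
      (tTilde (2 * k) / ((i + 1 - 2 * k).factorial : ℂ))).mul_left 2).tendsto_sum_nat)
  have hlim := (((tendsto_const_nhds (x := ∑ β ∈ ratPoles r,
    residue (integrand (i + 1) r) β)).add hl1).add hl2).add hl3
  have hzero := (tendsto_circleIntegral_integrand i hr).const_mul (2 * Real.pi * Complex.I)⁻¹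
  rw [mul_zero] at hzero
  have heq := tendsto_nhds_unique (hlim.congr' ?_) hzero
  · linear_combination heq
  · filter_upwards [eventually_ge_atTop ⌈M⌉₊] with N hN
    rw [circleIntegral_integrand_eq i h0 hn fun z hz =>
      (hpole z hz).trans_le (Nat.ceil_le.1 hN),
      inv_mul_cancel_left₀ Complex.two_pi_I_ne_zero]
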